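/- **Setting.** Let $(X,\rho)$ be a metric space with at least two points, equipped with a Borel measure $\mu$ such that $0<\mu(B(x,r))<\infty$ for every ball $B(x,r):=\{y\in X:\rho(x,y)<r\}$ with $x\in X$, $r\in(0,\infty)$. Write ${\rm diam}(X):=\sup_{x,y\in X}\rho(x,y)\in(0,\infty]$. For a $\mu$-measurable $u:X\to\mathbb R$, let $\mathcal D(u)$ be the set of all nonnegative $\mu$-measurable functions $g$ on $X$ for which there is a set $E$ with $\mu(E)=0$ and $$|u(x)-u(y)|\le\rho(x,y)\,[g(x)+g(y)]\quad\text{for all }x,y\in X\setminus E .$$ For $p\in(0,\infty)$ put $\|u\|_{\dot M^{1,p}(X)}:=\inf_{g\in\mathcal D(u)}\|g\|_{L^p(X)}$ (with $\inf\emptyset:=\infty$), and let $\dot M^{1,p}(X)$ be the set of all $\mu$-measurable $u:X\to\mathbb R$ with $\|u\|_{\dot M^{1,p}(X)}<\infty$. Let $Q\in(0,\infty)$. The measure $\mu$ is *$Q$-doubling* if there is $\kappa>0$ with $\kappa\,(r/R)^Q\le\mu(B(x,r))/\mu(B(y,R))$ whenever $B(x,r)\subset B(y,R)$ and $0<r\le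 R<\infty$. The space is *uniformly perfect* if there is $\lambda\in(0,1)$ such that, for all $x\in X$ and $r\in(0,\infty)$, $B(x,r)\setminus B(x,\lambda r)\ne\emptyset$ whenever $X\setminus B(x,r)\neq\emptyset$. **Theorem 1.4.** Suppose that $X$ is bounded or that $\mu$ is $Q$-doubling. Then the following two statements are equivalent. (a) $\mu$ is lower $Q$-Ahlfors-regular: there is $\kappa>0$ such that $\kappa r^Q\le\mu(B(x,r))$ for all $x\in X$ and all finite $r\in(0,{\rm diam}(X)]$. (b) There exist $p\in(0,Q)$ and $C_S\in(0,\infty)$ such that, with $p^*:=Qp/(Q-p)$, $$\|u\|_{L^{p^*}(X)}\le C_S\|u\|_{\dot M^{1,p}(X)}+\frac{C_S}{{\rm diam}(X)}\|u\|_{L^p(X)}\quad\text{for all }u\in\dot M^{1,p}(X),$$ where the last term is understood to be $+\infty$ if $u\notin L^p(X)$, and to be $0$ if ${\rm diam}(X)=\infty$ and $u\in L^p(X)$. If, in addition, $(X,\rho)$ is uniformly perfect, then (a) and (b) are further equivalent to each of the following statements. (c) There exist $p\in(0,Q)$ and $C_P\in(0,\infty)$ such that, with $p^*:=Qp/(Q-p)$,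 $$\inf_{\gamma\in\mathbb R}\|u-\gamma\|_{L^{p^*}(X)}\le C_P\|u\|_{\dot M^{1,p}(X)}\quad\text{for all }u\in\dot M^{1,p}(X).$$ (d) There exist $c_1,c_2,\omega\in(0,\infty)$ such that, for every ball $B\subset X$ of radius at most ${\rm diam}(X)$ and every $u\in\dot M^{1,Q}(X)$ that is not $\mu$-almost everywhere constant, $u$ is integrable over $B$ and, with $u_B:=\frac1{\mu(B)}\int_B u\,d\mu$, $$\frac1{\mu(B)}\int_B\exp\left[\left(c_1\frac{|u-u_B|}{\|u\|_{\dot M^{1,Q}(X)}}\right)^{\omega}\right]d\mu\le c_2 .$$ (e) There exist $p\in(Q,\infty)$ and $C_H\in(0,\infty)$ such that every $u\in\dot M^{1,p}(X)$ agrees $\mu$-almost everywhere with a function $v:X\to\mathbb R$ satisfying $$|v(x)-v(y)|\le C_H\,[\rho(x,y)]^{1-Q/p}\,\|u\|_{\dot M^{1,p}(X)}\quad\text{for all }x,y\in X .$$ -/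

import Mathlib

open MeasureTheory Metric Set
open scoped ENNReal

noncomputable section

namespace HajlaszSobolev

variable {X : Type*} [MetricSpace X] [MeasurableSpace X]

/-- All balls have positive and finite measure. -/
def BallsPosFinite (μ : Measure X) : Prop :=
  ∀ (x : X) (r : ℝ), 0 < r → 0 < μ (ball x r) ∧ μ (ball x r) < ∞

/-- `μ` is lower `Q`-Ahlfors-regular: for some `κ > 0`, `κ r ^ Q ≤ μ (B(x, r))` for all `x` and
all finite `r` in `(0, diam X]`. -/
def LowerAhlforsRegular (μ : Measure X) (Q : ℝ) : Prop :=
  ∃ κ : ℝ, 0 < κ ∧ ∀ (x : X) (r : ℝ), 0 < r → ENNReal.ofReal r ≤ ediam (univ : Set X) →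
    ENNReal.ofReal (κ * r ^ Q) ≤ μ (ball x r)

/-- `μ` is `Q`-doubling: for some `κ > 0`, `κ (r / R) ^ Q ≤ μ (B(x, r)) / μ (B(y, R))` whenever
`B(x, r) ⊆ B(y, R)` and `0 < r ≤ R < ∞`. -/
def QDoubling (μ : Measure X) (Q : ℝ) : Prop :=
  ∃ κ : ℝ, 0 < κ ∧ ∀ (x y : X) (r R : ℝ), 0 < r → r ≤ R → ball x r ⊆ ball y R →
    ENNReal.ofReal (κ * (r / R) ^ Q) ≤ μ (ball x r) / μ (ball y R)

/-- Uniform perfectness: for some `lam` in `(0, 1)`, the set `B(x, r) \ B(x, lam r)` is nonempty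
whenever `X \ B(x, r)` is. -/
def UniformlyPerfect (X : Type*) [MetricSpace X] : Prop :=
  ∃ lam : ℝ, 0 < lam ∧ lam < 1 ∧ ∀ (x : X) (r : ℝ), 0 < r →
    ((univ : Set X) \ ball x r).Nonempty → (ball x r \ ball x (lam * r)).Nonempty

/-- `g` is a Hajłasz gradient (a `1`-gradient) of `u`: it is nonnegative, `μ`-measurable, and
`|u x - u y| ≤ d(x, y) (g x + g y)` for all `x, y` outside a `μ`-null set. -/
def IsHajlaszGradient (μ : Measure X) (u g : X → ℝ) : Prop :=
  AEMeasurable g μ ∧ (∀ x, 0 ≤ g x) ∧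
    ∃ E : Set X, μ E = 0 ∧ ∀ x ∉ E, ∀ y ∉ E, |u x - u y| ≤ dist x y * (g x + g y)

/-- The homogeneous Hajłasz–Sobolev (quasi-)seminorm of order `(1, p)`: the infimum of the `L^p`
(quasi-)norms of the Hajłasz gradients of `u`, with the infimum of the empty set equal to `∞`. -/
def hajlaszSeminorm (μ : Measure X) (p : ℝ) (u : X → ℝ) : ℝ≥0∞ :=
  ⨅ (g : X → ℝ) (_ : IsHajlaszGradient μ u g), eLpNorm g (ENNReal.ofReal p) μ

/-- Membership in the homogeneous Hajłasz–Sobolev space of order `(1, p)`. -/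
def MemHajlasz (μ : Measure X) (p : ℝ) (u : X → ℝ) : Prop :=
  AEMeasurable u μ ∧ hajlaszSeminorm μ p u < ∞

/-- The Sobolev conjugate exponent `p* = Q p / (Q - p)`, used for `0 < p < Q` only. -/
def sobolevExponent (Q p : ℝ) : ℝ := Q * p / (Q - p)

/-- The global Sobolev embedding, for some `p` in `(0, Q)`. If `X` is unbounded, the last term
is infinite for `u` not in `L^p`, and it vanishes (`C / ∞ = 0`) for `u` in `L^p`. -/
def GlobalSobolev (μ : Measure X) (Q : ℝ) : Prop :=
  ∃ p C : ℝ, 0 < p ∧ p < Q ∧ 0 < C ∧ ∀ u : X → ℝ, MemHajlasz μ p u →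
    (ediam (univ : Set X) = ∞ → eLpNorm u (ENNReal.ofReal p) μ < ∞) →
    eLpNorm u (ENNReal.ofReal (sobolevExponent Q p)) μ ≤
      ENNReal.ofReal C * hajlaszSeminorm μ p u +
        ENNReal.ofReal C / ediam (univ : Set X) * eLpNorm u (ENNReal.ofReal p) μ

/-- The global Sobolev–Poincaré inequality, for some `p` in `(0, Q)`. -/
def GlobalSobolevPoincare (μ : Measure X) (Q : ℝ) : Prop :=
  ∃ p C : ℝ, 0 < p ∧ p < Q ∧ 0 < C ∧ ∀ u : X → ℝ, MemHajlasz μ p u →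
    ⨅ γ : ℝ, eLpNorm (fun x => u x - γ) (ENNReal.ofReal (sobolevExponent Q p)) μ ≤
      ENNReal.ofReal C * hajlaszSeminorm μ p u

/-- The Trudinger-type inequality (`p = Q`), for balls of radius at most `diam X` and functions
that are not `μ`-a.e. constant; that `u` is integrable over the ball, so that its average over
the ball is meaningful, is part of the claim. -/
def GlobalTrudinger (μ : Measure X) (Q : ℝ) : Prop :=
  ∃ c₁ c₂ ω : ℝ, 0 < c₁ ∧ 0 < c₂ ∧ 0 < ω ∧
    ∀ (z : X) (r : ℝ), 0 < r → ENNReal.ofReal r ≤ ediam (univ : Set X) →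
    ∀ u : X → ℝ, MemHajlasz μ Q u → (¬ ∃ c : ℝ, ∀ᵐ x ∂μ, u x = c) →
      IntegrableOn u (ball z r) μ ∧
      ⨍⁻ x in ball z r, ENNReal.ofReal (Real.exp
        ((c₁ * (|u x - ⨍ y in ball z r, u y ∂μ| / (hajlaszSeminorm μ Q u).toReal)) ^ ω)) ∂μ
          ≤ ENNReal.ofReal c₂

/-- The Hölder-type embedding, for some `p` in `(Q, ∞)`. -/
def GlobalHolder (μ : Measure X) (Q : ℝ) : Prop :=
  ∃ p C : ℝ, 0 < p ∧ Q < p ∧ 0 < C ∧ ∀ u : X → ℝ, MemHajlasz μ p u →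
    ∃ v : X → ℝ, v =ᵐ[μ] u ∧
      ∀ x y : X, |v x - v y| ≤ C * dist x y ^ (1 - Q / p) * (hajlaszSeminorm μ p u).toReal

end HajlaszSobolev

end

namespace HajlaszSobolev

/-! ### Chaining along sublevel sets of a gradient. -/

section Chaining

variable {X : Type*} [MetricSpace X] [MeasurableSpace X] {μ : Measure X}

/-! From regularity to embeddings: let `g` be a gradient of `u` with `L^p` norm below `N`. By
Chebyshev a ball of measure at least `(N / s) ^ p` contains a point with `g ≤ s`, and lower
regularity says which radius suffices. A point with `g ≤ 2 ^ k s` can therefore be joined to one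
with `g ≤ s` by steps that halve the level of `g`. If `(N / s) ^ p = κ R ^ Q`, the step leading down
to level `2 ^ j s` has length at most `R τ ^ j` with `τ = 2 ^ (-p/Q)` and changes `u` by at most `3
s R (2τ) ^ j` (`exists_chain`, `abs_sub_le_of_chain`). The ratio `2τ = 2 ^ (1 - p/Q)` decides
everything. For `p < Q` the sum grows like `g ^ (1 - p/Q)`, whose `p*`-th power is `g ^ p`: this is
Sobolev–Poincaré. For `p = Q` it counts steps and gives `log g`: this is Trudinger. For `p > Q` it
converges, and `R = dist x y` gives Hölder continuity.

From embeddings to regularity: test on Lipschitz bumps between concentric balls. A bump between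
radii `R' < R` has a gradient `(R - R')⁻¹` supported in the larger ball, so a Sobolev or Trudinger
inequality bounds the measure of the smaller ball by a power greater than `1` of that of the larger
one. Along radii decreasing from `ρ` to `ρ / 2` this is a De Giorgi recursion, which would force the
measures to tend to zero if the first were small compared with `ρ ^ Q`; but the ball of radius `ρ /
2` has positive measure (`exists_le_of_iterate_le`). Hölder continuity needs only one bump.

In (c), (d) and (e) constants are invisible, so the bump must be compared with a second region where
it vanishes. Uniform perfectness supplies two disjoint balls of comparable radius
(`UniformlyPerfect.exists_disjoint_balls`); centring the bump at the one of smaller measure makes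
the lower bound independent of the constant subtracted. -/

lemma exists_gradient_of_hajlaszSeminorm_lt {p : ℝ} {N : ℝ≥0∞} {u : X → ℝ}
    (h : hajlaszSeminorm μ p u < N) :
    ∃ g, IsHajlaszGradient μ u g ∧ eLpNorm g (ENNReal.ofReal p) μ < N := by
  simpa [hajlaszSeminorm, iInf_lt_iff] using h

lemma hajlaszSeminorm_le {p : ℝ} {u g : X → ℝ} (h : IsHajlaszGradient μ u g) :
    hajlaszSeminorm μ p u ≤ eLpNorm g (ENNReal.ofReal p) μ :=
  iInf₂_le g h

/-- A set whose measure exceeds the Chebyshev bound for `{s < g}` meets `{g ≤ s}` off any given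
null set. -/
lemma exists_mem_le_of_le_measure {α : Type*} [MeasurableSpace α] {ν : Measure α} {p N s : ℝ}
    {g : α → ℝ} {E B : Set α} (hp : 0 < p)
    (hs : 0 < s) (hN : 0 < N) (hg : AEMeasurable g ν)
    (hgN : eLpNorm g (ENNReal.ofReal p) ν < ENNReal.ofReal N) (hE : ν E = 0)
    (hB : ENNReal.ofReal ((N / s) ^ p) ≤ ν B) : ∃ y ∈ B, y ∉ E ∧ g y ≤ s := by
  by_contra! hcon
  have hsub : B ⊆ E ∪ {y | ENNReal.ofReal s ≤ ‖g y‖ₑ} := by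
    intro y hy
    by_cases hyE : y ∈ E
    · exact Or.inl hyE
    · right
      have := hcon y hy hyE
      rw [mem_ofPred_eq, Real.enorm_eq_ofReal (hs.trans this).le]
      exact ENNReal.ofReal_le_ofReal this.le
  have hB' : ν B ≤ ν {y | ENNReal.ofReal s ≤ ‖g y‖ₑ} := by
    calc ν B ≤ _ := measure_mono hsub
      _ ≤ ν E + _ := measure_union_le _ _
      _ = _ := by rw [hE, zero_add]
  have h1 := mul_meas_ge_le_pow_eLpNorm' (p := ENNReal.ofReal p) ν
    (by simpa using hp) ENNReal.ofReal_ne_top hg.aestronglyMeasurable (ENNReal.ofReal s)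
  rw [ENNReal.toReal_ofReal hp.le] at h1
  have h2 : eLpNorm g (ENNReal.ofReal p) ν ^ p < ENNReal.ofReal N ^ p :=
    ENNReal.rpow_lt_rpow hgN hp
  have h3 : ENNReal.ofReal N ^ p = ENNReal.ofReal s ^ p * ENNReal.ofReal ((N / s) ^ p) := by
    rw [ENNReal.ofReal_rpow_of_pos hN, ENNReal.ofReal_rpow_of_pos hs,
      ← ENNReal.ofReal_mul (by positivity), ← Real.mul_rpow hs.le (by positivity),
      mul_div_cancel₀ _ hs.ne']
  have h4 : ENNReal.ofReal s ^ p * ENNReal.ofReal ((N / s) ^ p) ≤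
      ENNReal.ofReal s ^ p * ν {y | ENNReal.ofReal s ≤ ‖g y‖ₑ} := by
    gcongr
    exact hB.trans hB'
  exact absurd (h3 ▸ h4.trans h1) (not_le.mpr h2)

/-- Chaining from `{g ≤ 2 ^ k s}` down to `{g ≤ s}` through points at geometrically
controlled distances. -/
lemma exists_chain {p N s R τ : ℝ} {u g : X → ℝ} {E : Set X} (hp : 0 < p)
    (hs : 0 < s) (hN : 0 < N) (hg : AEMeasurable g μ)
    (hgN : eLpNorm g (ENNReal.ofReal p) μ < ENNReal.ofReal N) (hE : μ E = 0)
    (hEu : ∀ x ∉ E, ∀ y ∉ E, |u x - u y| ≤ dist x y * (g x + g y))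
    (hball : ∀ (j : ℕ) (x : X),
      ENNReal.ofReal ((N / (2 ^ j * s)) ^ p) ≤ μ (ball x (R * τ ^ j)))
    (k : ℕ) : ∀ x ∉ E, g x ≤ 2 ^ k * s → ∃ y ∉ E, g y ≤ s ∧
      dist x y ≤ R * ∑ j ∈ Finset.range k, τ ^ j ∧
      |u x - u y| ≤ 3 * s * R * ∑ j ∈ Finset.range k, (2 * τ) ^ j := by
  induction k with
  | zero =>
    intro x hx hgx
    exact ⟨x, hx, by simpa using hgx, by simp, by simp⟩
  | succ k ih =>
    intro x hx hgx
    obtain ⟨z, hzB, hzE, hgz⟩ := exists_mem_le_of_le_measure hp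
      (by positivity : 0 < 2 ^ k * s) hN hg hgN hE (hball k x)
    obtain ⟨y, hy, hgy, hd, hu⟩ := ih z hzE hgz
    have hd' : dist x z ≤ R * τ ^ k := by rw [dist_comm]; exact (mem_ball.mp hzB).le
    refine ⟨y, hy, hgy, ?_, ?_⟩
    · rw [Finset.sum_range_succ, mul_add]
      linarith [dist_triangle x z y]
    · rw [Finset.sum_range_succ, mul_add]
      have h1 : |u x - u z| ≤ 3 * s * R * (2 * τ) ^ k := by
        calc |u x - u z| ≤ dist x z * (g x + g z) := hEu x hx z hzE
          _ ≤ dist x z * (3 * (2 ^ k * s)) := by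
            gcongr
            rw [pow_succ] at hgx
            linarith
          _ ≤ R * τ ^ k * (3 * (2 ^ k * s)) := by gcongr
          _ = _ := by rw [mul_pow]; ring
      linarith [abs_sub_le (u x) (u z) (u y)]

/-- The oscillation bound obtained by chaining both points down to the level `s` attached to the
scale `R` by `(N / s) ^ p = κ R ^ Q`. -/
lemma abs_sub_le_of_chain {p Q κ N s R : ℝ} {u g : X → ℝ} {E : Set X} (hp : 0 < p) (hQ : 0 < Q)
    (hκ : ∀ (x : X) (r : ℝ), 0 < r → ENNReal.ofReal r ≤ ediam (univ : Set X) →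
      ENNReal.ofReal (κ * r ^ Q) ≤ μ (ball x r))
    (hs : 0 < s) (hN : 0 < N) (hg : AEMeasurable g μ)
    (hgN : eLpNorm g (ENNReal.ofReal p) μ < ENNReal.ofReal N) (hE : μ E = 0)
    (hEu : ∀ x ∉ E, ∀ y ∉ E, |u x - u y| ≤ dist x y * (g x + g y))
    (hR : 0 < R) (hRd : ENNReal.ofReal R ≤ ediam (univ : Set X)) (hsR : (N / s) ^ p = κ * R ^ Q)
    {x y : X} (hx : x ∉ E) (hy : y ∉ E) (hxy : dist x y ≤ 2 * R) {k l : ℕ}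
    (hgx : g x ≤ 2 ^ k * s) (hgy : g y ≤ 2 ^ l * s) :
    |u x - u y| ≤ s * R * (3 * (∑ j ∈ Finset.range k, ((2 : ℝ) ^ (1 - p / Q)) ^ j +
      ∑ j ∈ Finset.range l, ((2 : ℝ) ^ (1 - p / Q)) ^ j) +
      4 * (1 + (1 - (2 : ℝ) ^ (-(p / Q)))⁻¹)) := by
  -- With this ratio `κ (R τ ^ j) ^ Q` is exactly the Chebyshev bound at level `2 ^ j s`; since `τ <
  -- 1` all radii stay below `R`, hence below the diameter.
  set τ : ℝ := (2 : ℝ) ^ (-(p / Q)) with hτ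
  have hτ0 : 0 < τ := by positivity
  have hτ1 : τ < 1 := Real.rpow_lt_one_of_one_lt_of_neg one_lt_two (by simp; positivity)
  have h2τ : (2 : ℝ) ^ (1 - p / Q) = 2 * τ := by
    rw [sub_eq_add_neg, Real.rpow_add two_pos, Real.rpow_one]
  have hball : ∀ (j : ℕ) (x : X),
      ENNReal.ofReal ((N / (2 ^ j * s)) ^ p) ≤ μ (ball x (R * τ ^ j)) := by
    intro j x
    have h1 : (N / (2 ^ j * s)) ^ p = κ * (R * τ ^ j) ^ Q := by
      have e1 : N / (2 ^ j * s) = (N / s) * (2 ^ j)⁻¹ := by field_simp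
      rw [e1, Real.mul_rpow (by positivity) (by positivity), hsR,
        Real.mul_rpow hR.le (by positivity), mul_assoc]
      congr 2
      rw [hτ, ← Real.rpow_natCast, ← Real.rpow_natCast, ← Real.rpow_neg two_pos.le,
        ← Real.rpow_mul two_pos.le, ← Real.rpow_mul two_pos.le, ← Real.rpow_mul two_pos.le]
      congr 1
      field_simp
    rw [h1]
    refine hκ x _ (by positivity) (le_trans (ENNReal.ofReal_le_ofReal ?_) hRd)
    exact mul_le_of_le_one_right hR.le (pow_le_one₀ hτ0.le hτ1.le)
  obtain ⟨x', hx', hgx', hdx, hux⟩ := exists_chain hp hs hN hg hgN hE hEu hball k x hx hgx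
  obtain ⟨y', hy', hgy', hdy, huy⟩ := exists_chain hp hs hN hg hgN hE hEu hball l y hy hgy
  have hgeo : ∀ n : ℕ, R * ∑ j ∈ Finset.range n, τ ^ j ≤ R * (1 - τ)⁻¹ := fun n => by
    gcongr
    rw [← tsum_geometric_of_lt_one hτ0.le hτ1]
    exact (summable_geometric_of_lt_one hτ0.le hτ1).sum_le_tsum _ (fun _ _ => by positivity)
  have hd' : dist x' y' ≤ 2 * R + 2 * (R * (1 - τ)⁻¹) := by
    have h1 := dist_triangle4 x' x y y'
    rw [dist_comm x' x] at h1
    linarith [hgeo k, hgeo l]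
  have hmid : |u x' - u y'| ≤ (2 * R + 2 * (R * (1 - τ)⁻¹)) * (2 * s) := by
    calc _ ≤ dist x' y' * (g x' + g y') := hEu _ hx' _ hy'
      _ ≤ dist x' y' * (2 * s) := by gcongr; linarith
      _ ≤ _ := by gcongr
  rw [h2τ]
  have h1 := abs_sub_le (u x) (u x') (u y)
  have h2 := abs_sub_le (u x') (u y') (u y)
  rw [abs_sub_comm (u y') (u y)] at h2
  linarith

/-- The level `s` attached to the scale `R` by `(N / s) ^ p = κ R ^ Q`. -/
noncomputable def chainLevel (κ p Q N R : ℝ) : ℝ := N * (κ * R ^ Q) ^ (-(1 / p))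

lemma chainLevel_pos {κ p Q N R : ℝ} (hκ : 0 < κ) (hN : 0 < N) (hR : 0 < R) :
    0 < chainLevel κ p Q N R := by
  unfold chainLevel; positivity

lemma div_chainLevel_rpow {κ p Q N R : ℝ} (hκ : 0 < κ) (hN : 0 < N) (hR : 0 < R) (hp : 0 < p) :
    (N / chainLevel κ p Q N R) ^ p = κ * R ^ Q := by
  have : N / chainLevel κ p Q N R = (κ * R ^ Q) ^ (1 / p) := by
    rw [chainLevel, Real.rpow_neg (by positivity)]
    field_simp
  rw [this, ← Real.rpow_mul (by positivity), one_div, inv_mul_cancel₀ hp.ne', Real.rpow_one]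

/-- The size of the oscillation between two points already at level `s`: its power of `R` is
negative, zero or positive according to the sign of `p - Q`. -/
lemma chainLevel_mul {κ p Q N R : ℝ} (hκ : 0 < κ) (hR : 0 < R) :
    chainLevel κ p Q N R * R = κ ^ (-(1 / p)) * (N * R ^ (1 - Q / p)) := by
  rw [chainLevel, Real.mul_rpow hκ.le (by positivity), ← Real.rpow_mul hR.le]
  have : R ^ (1 - Q / p) = R ^ (Q * -(1 / p)) * R := by
    rw [← Real.rpow_add_one hR.ne']; congr 1; ring
  rw [this]; ring

lemma exists_two_pow_near (t : ℝ) : ∃ k : ℕ, t ≤ 2 ^ k ∧ (2 : ℝ) ^ k ≤ 2 * max 1 t := by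
  obtain ⟨n, h1, h2⟩ := exists_nat_pow_near (le_max_left 1 t) one_lt_two
  exact ⟨n + 1, (le_max_right _ _).trans h2.le, by rw [pow_succ]; linarith⟩

/-- If `|u x - u y| ≤ h x + h y` on a set, then `u` is within `h` of a single constant there. -/
lemma exists_const_of_abs_sub_le {α : Type*} {G : Set α} {u h : α → ℝ}
    (huh : ∀ x ∈ G, ∀ y ∈ G, |u x - u y| ≤ h x + h y) : ∃ γ : ℝ, ∀ x ∈ G, |u x - γ| ≤ h x := by
  rcases G.eq_empty_or_nonempty with rfl | hne
  · exact ⟨0, by simp⟩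
  have hle : ∀ x ∈ G, ∀ y ∈ G, u y - h y ≤ u x + h x := fun x hx y hy => by
    have := neg_abs_le (u x - u y)
    linarith [huh x hx y hy]
  have hne' : ((fun y => u y - h y) '' G).Nonempty := hne.image _
  -- Every `u y - h y` lies below every `u x + h x`, so the supremum separates the two families. No
  -- average is taken, so `u` need not be integrable.
  refine ⟨sSup ((fun y => u y - h y) '' G), fun x hx => ?_⟩
  have h1 : sSup ((fun y => u y - h y) '' G) ≤ u x + h x :=
    csSup_le hne' (by rintro _ ⟨y, hy, rfl⟩; exact hle x hx y hy)
  have h2 : u x - h x ≤ sSup ((fun y => u y - h y) '' G) :=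
    le_csSup ⟨u x + h x, by rintro _ ⟨y, hy, rfl⟩; exact hle x hx y hy⟩ ⟨x, hx, rfl⟩
  rw [abs_le]
  constructor <;> linarith

end Chaining

/-- The seminorm is an infimum that need not be attained and may vanish, so estimates are proved for
every positive `N` above it and passed to the limit. -/
lemma le_mul_add_of_forall_lt {a A b S : ℝ≥0∞} (hA : A ≠ ∞) (hS : S < ∞)
    (h : ∀ N : ℝ, 0 < N → S < ENNReal.ofReal N → a ≤ A * ENNReal.ofReal N + b) :
    a ≤ A * S + b := by
  have hlim : Filter.Tendsto (fun n : ℕ => A * ENNReal.ofReal (S.toReal + 1 / ((n : ℝ) + 1)) + b)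
      Filter.atTop (nhds (A * S + b)) := by
    refine Filter.Tendsto.add (ENNReal.Tendsto.const_mul ?_ (Or.inr hA)) tendsto_const_nhds
    have h1 : Filter.Tendsto (fun n : ℕ => S.toReal + 1 / ((n : ℝ) + 1)) Filter.atTop
        (nhds (S.toReal + 0)) := tendsto_const_nhds.add tendsto_one_div_add_atTop_nhds_zero_nat
    have h2 := ENNReal.tendsto_ofReal h1
    rwa [add_zero, ENNReal.ofReal_toReal hS.ne] at h2
  refine ge_of_tendsto' hlim fun n => h _ (by positivity) ?_
  rw [← ENNReal.ofReal_toReal hS.ne]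
  refine (ENNReal.ofReal_lt_ofReal_iff (by positivity)).2 ?_
  rw [ENNReal.toReal_ofReal ENNReal.toReal_nonneg]
  have : (0 : ℝ) < 1 / ((n : ℝ) + 1) := by positivity
  linarith

/-! ### The case `p < Q`: Sobolev–Poincaré and Sobolev inequalities. -/

section Subcritical

variable {X : Type*} [MetricSpace X] [MeasurableSpace X] {μ : Measure X}

/-- Subcritical pointwise estimate at scale `R`. -/
lemma exists_abs_sub_le_of_lt {p Q κ : ℝ} (hp : 0 < p) (hpQ : p < Q) (hκ0 : 0 < κ)
    (hκ : ∀ (x : X) (r : ℝ), 0 < r → ENNReal.ofReal r ≤ ediam (univ : Set X) →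
      ENNReal.ofReal (κ * r ^ Q) ≤ μ (ball x r)) :
    ∃ C : ℝ, 0 < C ∧ ∀ (N R : ℝ) (u g : X → ℝ) (E : Set X), 0 < N → 0 < R →
      ENNReal.ofReal R ≤ ediam (univ : Set X) → AEMeasurable g μ → (∀ x, 0 ≤ g x) →
      eLpNorm g (ENNReal.ofReal p) μ < ENNReal.ofReal N → μ E = 0 →
      (∀ x ∉ E, ∀ y ∉ E, |u x - u y| ≤ dist x y * (g x + g y)) →
      ∀ x ∉ E, ∀ y ∉ E, dist x y ≤ 2 * R →
        |u x - u y| ≤ C * (N ^ (p / Q) * (g x ^ (1 - p / Q) + g y ^ (1 - p / Q)) +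
          N * R ^ (1 - Q / p)) := by
  have hQ : 0 < Q := hp.trans hpQ
  set σ : ℝ := (2 : ℝ) ^ (1 - p / Q) with hσ
  have hβ : 0 < 1 - p / Q := by rw [sub_pos, div_lt_one hQ]; exact hpQ
  have hβ1 : 1 - p / Q ≤ 1 := by have : 0 < p / Q := by positivity
                                 linarith
  have hσ1 : 1 < σ := Real.one_lt_rpow one_lt_two hβ
  have hσ2 : σ ≤ 2 := by
    calc σ ≤ (2 : ℝ) ^ (1 : ℝ) := Real.rpow_le_rpow_of_exponent_le one_le_two hβ1
      _ = 2 := Real.rpow_one 2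
  set A : ℝ := 6 / (σ - 1) with hA
  have hA0 : 0 < A := div_pos (by norm_num) (by linarith)
  have hτ1 : (2 : ℝ) ^ (-(p / Q)) < 1 :=
    Real.rpow_lt_one_of_one_lt_of_neg one_lt_two (by simp; positivity)
  set B : ℝ := 4 * (1 + (1 - (2 : ℝ) ^ (-(p / Q)))⁻¹) with hB
  have hB0 : 0 < B := by
    have : 0 < (1 - (2 : ℝ) ^ (-(p / Q)))⁻¹ := inv_pos.2 (by linarith)
    positivity
  refine ⟨(2 * A + B) * (κ ^ (-(1 / Q)) + κ ^ (-(1 / p))), by positivity, ?_⟩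
  intro N R u g E hN hR hRd hg hg0 hgN hE hEu x hx y hy hxy
  set s : ℝ := chainLevel κ p Q N R with hs
  have hs0 : 0 < s := chainLevel_pos hκ0 hN hR
  have hsR : (N / s) ^ p = κ * R ^ Q := div_chainLevel_rpow hκ0 hN hR hp
  have hsR1 : s * R = κ ^ (-(1 / p)) * (N * R ^ (1 - Q / p)) := chainLevel_mul hκ0 hR
  -- The powers of `R` cancel, so the coefficient of `g ^ (1 - p / Q)` does not depend on the scale
  -- and only the term `N * R ^ (1 - Q / p)` does.
  have hsR2 : s ^ (p / Q) * R = κ ^ (-(1 / Q)) * N ^ (p / Q) := by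
    rw [hs, chainLevel, Real.mul_rpow hN.le (by positivity), ← Real.rpow_mul (by positivity),
      Real.mul_rpow hκ0.le (by positivity), ← Real.rpow_mul hR.le]
    have e1 : -(1 / p) * (p / Q) = -(1 / Q) := by field_simp
    have e2 : Q * -(1 / Q) = -1 := by field_simp
    rw [e1, e2, Real.rpow_neg_one]
    field_simp
  have hlev : ∀ z, ∃ k : ℕ, g z ≤ 2 ^ k * s ∧
      s * R * ∑ j ∈ Finset.range k, σ ^ j ≤ 2 / (σ - 1) * (s * R +
        κ ^ (-(1 / Q)) * N ^ (p / Q) * g z ^ (1 - p / Q)) := by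
    intro z
    obtain ⟨k, hk1, hk2⟩ := exists_two_pow_near (g z / s)
    refine ⟨k, (div_le_iff₀ hs0).1 hk1, ?_⟩
    have hgz : 0 ≤ g z / s := div_nonneg (hg0 z) hs0.le
    -- Since `σ > 1`, the geometric sum is comparable to its last term, and `2 ^ k` is at most about
    -- `g z / s`.
    have h1 : σ ^ k ≤ 2 * (1 + (g z / s) ^ (1 - p / Q)) := by
      calc σ ^ k = ((2 : ℝ) ^ k) ^ (1 - p / Q) := by
            rw [hσ, ← Real.rpow_natCast, ← Real.rpow_natCast, ← Real.rpow_mul two_pos.le,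
              ← Real.rpow_mul two_pos.le, mul_comm]
        _ ≤ (2 * max 1 (g z / s)) ^ (1 - p / Q) := by gcongr
        _ = σ * (max 1 (g z / s)) ^ (1 - p / Q) := by
            rw [Real.mul_rpow two_pos.le (by positivity)]
        _ ≤ 2 * (1 + (g z / s) ^ (1 - p / Q)) := by
            gcongr
            have h3 : 0 ≤ (g z / s) ^ (1 - p / Q) := by positivity
            rcases max_cases 1 (g z / s) with ⟨h, _⟩ | ⟨h, _⟩ <;> rw [h]
            · rw [Real.one_rpow]; linarith
            · linarith
    have h2 : ∑ j ∈ Finset.range k, σ ^ j ≤ 2 / (σ - 1) * (1 + (g z / s) ^ (1 - p / Q)) := by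
      rw [geom_sum_eq hσ1.ne', div_mul_eq_mul_div]
      gcongr
      · linarith
    have h3 : s * R * (g z / s) ^ (1 - p / Q) =
        κ ^ (-(1 / Q)) * N ^ (p / Q) * g z ^ (1 - p / Q) := by
      rw [← hsR2, Real.div_rpow (hg0 z) hs0.le, Real.rpow_sub hs0, Real.rpow_one]
      field_simp
    calc _ ≤ s * R * (2 / (σ - 1) * (1 + (g z / s) ^ (1 - p / Q))) := by gcongr
      _ = 2 / (σ - 1) * (s * R + s * R * (g z / s) ^ (1 - p / Q)) := by ring
      _ = _ := by rw [h3]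
  obtain ⟨k, hk, hk'⟩ := hlev x
  obtain ⟨l, hl, hl'⟩ := hlev y
  have key := abs_sub_le_of_chain hp hQ hκ hs0 hN hg hgN hE hEu hR hRd hsR hx hy hxy hk hl
  rw [← hσ, ← hB] at key
  have hx0 : 0 ≤ N ^ (p / Q) * (g x ^ (1 - p / Q) + g y ^ (1 - p / Q)) := by
    have := hg0 x; have := hg0 y; positivity
  have hR0 : 0 ≤ N * R ^ (1 - Q / p) := by positivity
  set P := N ^ (p / Q) * (g x ^ (1 - p / Q) + g y ^ (1 - p / Q)) with hP
  set T := N * R ^ (1 - Q / p) with hT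
  have hκ1 : 0 < κ ^ (-(1 / Q)) := by positivity
  have hκ2 : 0 < κ ^ (-(1 / p)) := by positivity
  calc |u x - u y| ≤ _ := key
    _ ≤ A * (2 * (s * R) + κ ^ (-(1 / Q)) * P) + B * (s * R) := by
      have hA' : A = 3 * (2 / (σ - 1)) := by rw [hA]; ring
      rw [hA', hP]
      linarith
    _ = A * κ ^ (-(1 / Q)) * P + (2 * A + B) * κ ^ (-(1 / p)) * T := by rw [hsR1]; ring
    _ ≤ (2 * A + B) * (κ ^ (-(1 / Q)) + κ ^ (-(1 / p))) * P +
        (2 * A + B) * (κ ^ (-(1 / Q)) + κ ^ (-(1 / p))) * T := by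
      gcongr
      · linarith
      · linarith
      · linarith
    _ = _ := by ring

lemma measure_univ_lt_top_of_ediam [Nonempty X] (hμ : BallsPosFinite μ)
    (hd : ediam (univ : Set X) ≠ ∞) : μ univ < ∞ := by
  obtain ⟨x⟩ := ‹Nonempty X›
  refine lt_of_le_of_lt (measure_mono fun y _ => ?_)
    (hμ x ((ediam (univ : Set X)).toReal + 1) (by positivity)).2
  rw [mem_ball]
  have h := edist_le_ediam_of_mem (mem_univ y) (mem_univ x)
  have := ENNReal.toReal_mono hd h
  rw [edist_dist, ENNReal.toReal_ofReal dist_nonneg] at this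
  linarith

lemma sobolevExponent_pos {p Q : ℝ} (hp : 0 < p) (hpQ : p < Q) : 0 < sobolevExponent Q p :=
  div_pos (mul_pos (hp.trans hpQ) hp) (by linarith)

lemma ediam_univ_pos {Y : Type*} [MetricSpace Y] [Nontrivial Y] : 0 < ediam (univ : Set Y) :=
  ediam_pos_iff.2 nontrivial_univ

/-- The strong Sobolev–Poincaré inequality on a lower Ahlfors-regular space, in terms of any bound
for the seminorm. -/
lemma LowerAhlforsRegular.exists_const_eLpNorm_sub_le [Nontrivial X] {p Q : ℝ} (hp : 0 < p)
    (hpQ : p < Q) (hμ : BallsPosFinite μ) (h : LowerAhlforsRegular μ Q) :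
    ∃ C : ℝ, 0 < C ∧ ∀ (N : ℝ) (u : X → ℝ), 0 < N → hajlaszSeminorm μ p u < ENNReal.ofReal N →
      ∃ γ : ℝ, eLpNorm (fun x => u x - γ) (ENNReal.ofReal (sobolevExponent Q p)) μ ≤
        ENNReal.ofReal C * ENNReal.ofReal N := by
  obtain ⟨κ, hκ0, hκ⟩ := h
  have hQ : 0 < Q := hp.trans hpQ
  have hβ : 0 < 1 - p / Q := by rw [sub_pos, div_lt_one hQ]; exact hpQ
  obtain ⟨C, hC, key⟩ := exists_abs_sub_le_of_lt hp hpQ hκ0 hκ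
  set q := ENNReal.ofReal (sobolevExponent Q p) with hq
  obtain ⟨c, hc0, hcfin, hc⟩ : ∃ c : ℝ, 0 ≤ c ∧ eLpNorm (fun _ : X => c) q μ < ∞ ∧
      ∀ (N : ℝ) (u g : X → ℝ) (E : Set X), 0 < N → AEMeasurable g μ → (∀ x, 0 ≤ g x) →
      eLpNorm g (ENNReal.ofReal p) μ < ENNReal.ofReal N → μ E = 0 →
      (∀ x ∉ E, ∀ y ∉ E, |u x - u y| ≤ dist x y * (g x + g y)) →
      ∀ x ∉ E, ∀ y ∉ E,
        |u x - u y| ≤ C * (N ^ (p / Q) * (g x ^ (1 - p / Q) + g y ^ (1 - p / Q)) + N * c) := by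
    -- On an unbounded space `R → ∞` removes the remainder, since `1 - Q / p < 0`. On a bounded one
    -- `R` is the diameter and the remainder is a constant, with finite norm because `μ` is finite.
    by_cases hd : ediam (univ : Set X) = ∞
    · refine ⟨0, le_rfl, by simp, ?_⟩
      intro N u g E hN hg hg0 hgN hE hEu x hx y hy
      have hlim : Filter.Tendsto (fun R : ℝ => C * (N ^ (p / Q) *
          (g x ^ (1 - p / Q) + g y ^ (1 - p / Q)) + N * R ^ (1 - Q / p))) Filter.atTop
          (nhds (C * (N ^ (p / Q) * (g x ^ (1 - p / Q) + g y ^ (1 - p / Q)) + N * 0))) := by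
        have h1 : Filter.Tendsto (fun R : ℝ => R ^ (1 - Q / p)) Filter.atTop (nhds 0) := by
          have := tendsto_rpow_neg_atTop (y := Q / p - 1)
            (by rw [sub_pos, one_lt_div hp]; exact hpQ)
          simpa using this
        exact ((h1.const_mul N).const_add _).const_mul C
      refine ge_of_tendsto hlim ?_
      filter_upwards [Filter.eventually_gt_atTop 0, Filter.eventually_ge_atTop (dist x y)]
        with R hR hR'
      exact key N R u g E hN hR (by simp [hd]) hg hg0 hgN hE hEu x hx y hy (by linarith)
    · have hfin := measure_univ_lt_top_of_ediam hμ hd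
      have hR : 0 < (ediam (univ : Set X)).toReal := ENNReal.toReal_pos ediam_univ_pos.ne' hd
      refine ⟨(ediam (univ : Set X)).toReal ^ (1 - Q / p), by positivity, ?_, ?_⟩
      · have : IsFiniteMeasure μ := ⟨hfin⟩
        exact (memLp_const _).2
      · intro N u g E hN hg hg0 hgN hE hEu x hx y hy
        refine key N _ u g E hN hR (ENNReal.ofReal_toReal hd).le hg hg0 hgN hE hEu x hx y hy ?_
        have := ENNReal.toReal_mono hd (edist_le_ediam_of_mem (mem_univ x) (mem_univ y))
        rw [edist_dist, ENNReal.toReal_ofReal dist_nonneg] at this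
        linarith
  set K : ℝ≥0∞ := ENNReal.LpAddConst q * (1 + eLpNorm (fun _ : X => c) q μ) with hK
  have hKtop : K ≠ ∞ := ENNReal.mul_ne_top (ENNReal.LpAddConst_lt_top _).ne
    (ENNReal.add_ne_top.2 ⟨ENNReal.one_ne_top, hcfin.ne⟩)
  refine ⟨C * (K.toReal + 1), by positivity, fun N u hN hu => ?_⟩
  obtain ⟨g, ⟨hg, hg0, E, hE, hEu⟩, hgN⟩ := exists_gradient_of_hajlaszSeminorm_lt hu
  obtain ⟨γ, hγ⟩ := exists_const_of_abs_sub_le (G := Eᶜ) (u := u)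
    (h := fun x => C * N ^ (p / Q) * g x ^ (1 - p / Q) + C * N * c) (fun x hx y hy => by
      refine (hc N u g E hN hg hg0 hgN hE hEu x hx y hy).trans ?_
      have : 0 ≤ C * N * c := by positivity
      linarith)
  refine ⟨γ, ?_⟩
  have hae : ∀ᵐ x ∂μ, ‖u x - γ‖ ≤ C * N ^ (p / Q) * g x ^ (1 - p / Q) + C * N * c := by
    filter_upwards [compl_mem_ae_iff.2 hE] with x hx
    exact hγ x hx
  have hgm : AEStronglyMeasurable (fun x => g x ^ (1 - p / Q)) μ :=
    (hg.pow_const _).aestronglyMeasurable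
  have hgn : eLpNorm (fun x => g x ^ (1 - p / Q)) q μ ≤ ENNReal.ofReal (N ^ (1 - p / Q)) := by
    have e1 : (fun x => g x ^ (1 - p / Q)) = fun x => ‖g x‖ ^ (1 - p / Q) := by
      ext x; rw [Real.norm_of_nonneg (hg0 x)]
    -- The identity `p* (1 - p/Q) = p` turns the `L^{p*}` norm of `g ^ (1 - p/Q)` into a power of
    -- the `L^p` norm of `g`.
    have e2 : q * ENNReal.ofReal (1 - p / Q) = ENNReal.ofReal p := by
      rw [hq, ← ENNReal.ofReal_mul (sobolevExponent_pos hp hpQ).le, sobolevExponent]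
      congr 1
      have : Q - p ≠ 0 := by linarith
      field_simp
    rw [e1, eLpNorm_norm_rpow _ hβ, e2, ← ENNReal.ofReal_rpow_of_pos hN]
    gcongr
  have hfirst : eLpNorm (fun x => C * N ^ (p / Q) * g x ^ (1 - p / Q)) q μ ≤
      ENNReal.ofReal (C * N) := by
    have := eLpNorm_const_smul (p := q) (μ := μ) (C * N ^ (p / Q)) (fun x => g x ^ (1 - p / Q))
    simp only [Pi.smul_def, smul_eq_mul] at this
    rw [this, Real.enorm_eq_ofReal (by positivity)]
    calc _ ≤ ENNReal.ofReal (C * N ^ (p / Q)) * ENNReal.ofReal (N ^ (1 - p / Q)) := by gcongr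
      _ = _ := by
        rw [← ENNReal.ofReal_mul (by positivity), mul_assoc, ← Real.rpow_add hN]
        simp
  have hsecond : eLpNorm (fun _ : X => C * N * c) q μ =
      ENNReal.ofReal (C * N) * eLpNorm (fun _ : X => c) q μ := by
    have := eLpNorm_const_smul (p := q) (μ := μ) (C * N) (fun _ : X => c)
    simp only [Pi.smul_def, smul_eq_mul] at this
    rw [this, Real.enorm_eq_ofReal (by positivity)]
  calc _ ≤ eLpNorm (fun x => C * N ^ (p / Q) * g x ^ (1 - p / Q) + C * N * c) q μ :=
        eLpNorm_mono_ae_real hae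
    _ ≤ ENNReal.LpAddConst q * (eLpNorm (fun x => C * N ^ (p / Q) * g x ^ (1 - p / Q)) q μ +
          eLpNorm (fun _ : X => C * N * c) q μ) :=
        eLpNorm_add_le' (hgm.const_mul _) aestronglyMeasurable_const q
    _ ≤ ENNReal.LpAddConst q * (ENNReal.ofReal (C * N) +
          ENNReal.ofReal (C * N) * eLpNorm (fun _ : X => c) q μ) := by
        rw [hsecond]; gcongr
    _ = ENNReal.ofReal (C * N) * K := by rw [hK]; ring
    _ ≤ ENNReal.ofReal (C * N) * ENNReal.ofReal (K.toReal + 1) := by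
        gcongr
        rw [← ENNReal.ofReal_toReal hKtop]
        exact ENNReal.ofReal_le_ofReal (by rw [ENNReal.toReal_ofReal ENNReal.toReal_nonneg]; linarith)
    _ = _ := by
        rw [← ENNReal.ofReal_mul (by positivity), ← ENNReal.ofReal_mul (by positivity)]
        congr 1; ring

lemma LowerAhlforsRegular.globalSobolevPoincare [Nontrivial X] {Q : ℝ} (hQ : 0 < Q)
    (hμ : BallsPosFinite μ) (h : LowerAhlforsRegular μ Q) : GlobalSobolevPoincare μ Q := by
  have hp : 0 < Q / 2 := by positivity
  have hpQ : Q / 2 < Q := by linarith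
  obtain ⟨C, hC, key⟩ := h.exists_const_eLpNorm_sub_le hp hpQ hμ
  refine ⟨Q / 2, C, hp, hpQ, hC, fun u hu => ?_⟩
  have := le_mul_add_of_forall_lt (b := 0) (ENNReal.ofReal_ne_top (r := C)) hu.2
    (a := ⨅ γ : ℝ, eLpNorm (fun x => u x - γ) (ENNReal.ofReal (sobolevExponent Q (Q / 2))) μ)
    (fun N hN hS => by
      obtain ⟨γ, hγ⟩ := key N u hN hS
      rw [add_zero]
      exact (iInf_le _ γ).trans hγ)
  rwa [add_zero] at this

/-- If `γ ≠ 0`, at each point `|u|` or `|u - γ|` is at least `|γ| / 2`; Chebyshev makes both sets of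
finite measure, yet they cover a space of infinite measure. -/
lemma eq_zero_of_eLpNorm_sub_const_lt_top {α : Type*} [MeasurableSpace α] {ν : Measure α}
    {p q : ℝ≥0∞} (hp : p ≠ 0) (hp' : p ≠ ∞) (hq : q ≠ 0) (hq' : q ≠ ∞) (hν : ν univ = ∞)
    {u : α → ℝ} (hu : AEMeasurable u ν) {γ : ℝ} (h1 : eLpNorm u p ν < ∞)
    (h2 : eLpNorm (fun x => u x - γ) q ν < ∞) : γ = 0 := by
  by_contra hγ
  have hε : ENNReal.ofReal (|γ| / 2) ≠ 0 := by
    simpa using hγ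
  have m1 := MemLp.meas_ge_lt_top' (μ := ν) ⟨hu.aestronglyMeasurable, h1⟩ hp hp' hε
  have m2 := MemLp.meas_ge_lt_top' (μ := ν)
    ⟨(hu.sub_const γ).aestronglyMeasurable, h2⟩ hq hq' hε
  have hcover : (univ : Set α) ⊆ {x | ENNReal.ofReal (|γ| / 2) ≤ ‖u x‖ₑ} ∪
      {x | ENNReal.ofReal (|γ| / 2) ≤ ‖u x - γ‖ₑ} := by
    intro x _
    by_contra hx
    simp only [mem_union, mem_ofPred_eq, not_or, not_le, ← ofReal_norm, Real.norm_eq_abs,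
      ENNReal.ofReal_lt_ofReal_iff (show 0 < |γ| / 2 by positivity)] at hx
    have := abs_sub (u x) (u x - γ)
    rw [sub_sub_cancel] at this
    linarith
  have := (measure_mono hcover).trans (measure_union_le (μ := ν) _ _)
  rw [hν, top_le_iff] at this
  exact (ENNReal.add_lt_top.2 ⟨m1, m2⟩).ne this

lemma LowerAhlforsRegular.measure_univ_eq_top [Nonempty X] {Q : ℝ} (hQ : 0 < Q)
    (h : LowerAhlforsRegular μ Q) (hd : ediam (univ : Set X) = ∞) : μ univ = ∞ := by
  obtain ⟨κ, hκ0, hκ⟩ := h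
  obtain ⟨x⟩ := ‹Nonempty X›
  have hlim : Filter.Tendsto (fun R : ℝ => ENNReal.ofReal (κ * R ^ Q)) Filter.atTop
      (nhds ∞) :=
    ENNReal.tendsto_ofReal_atTop.comp ((tendsto_rpow_atTop hQ).const_mul_atTop hκ0)
  refine top_le_iff.1 (le_of_tendsto hlim ?_)
  filter_upwards [Filter.eventually_gt_atTop 0] with R hR
  exact (hκ x R hR (by simp [hd])).trans (measure_mono (subset_univ _))

lemma LowerAhlforsRegular.globalSobolev [Nontrivial X] {Q : ℝ} (hQ : 0 < Q)
    (hμ : BallsPosFinite μ) (h : LowerAhlforsRegular μ Q) : GlobalSobolev μ Q := by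
  obtain ⟨p, hp, hpQ⟩ : ∃ p : ℝ, 0 < p ∧ p < Q := ⟨Q / 2, by positivity, by linarith⟩
  obtain ⟨C, hC, key⟩ := h.exists_const_eLpNorm_sub_le hp hpQ hμ
  have hq0 := sobolevExponent_pos hp hpQ
  by_cases hd : ediam (univ : Set X) = ∞
  · refine ⟨p, C, hp, hpQ, hC, fun u hu hfin => ?_⟩
    rw [hd, ENNReal.div_top, zero_mul]
    refine le_mul_add_of_forall_lt ENNReal.ofReal_ne_top hu.2 (fun N hN hS => ?_)
    obtain ⟨γ, hγ⟩ := key N u hN hS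
    have hγ0 : γ = 0 := eq_zero_of_eLpNorm_sub_const_lt_top (by simpa using hp)
      ENNReal.ofReal_ne_top (by simpa using hq0) ENNReal.ofReal_ne_top
      (h.measure_univ_eq_top hQ hd) hu.1 (hfin hd)
      (hγ.trans_lt (ENNReal.mul_lt_top ENNReal.ofReal_lt_top ENNReal.ofReal_lt_top))
    simpa [hγ0] using hγ
  · have hM := measure_univ_lt_top_of_ediam hμ hd
    have hM0 : μ univ ≠ 0 := by
      obtain ⟨x⟩ : Nonempty X := inferInstance
      exact ((hμ x 1 one_pos).1.trans_le (measure_mono (subset_univ _))).ne'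
    set P := ENNReal.ofReal p with hP
    set q := ENNReal.ofReal (sobolevExponent Q p) with hq
    have hPq : P ≤ q := by
      refine ENNReal.ofReal_le_ofReal ?_
      rw [sobolevExponent, le_div_iff₀ (by linarith)]
      nlinarith
    -- `T` and `T'` convert between `L^q` and `L^P` norms on a finite measure space: `T` is exact
    -- for constants, `T'` comes from Hölder. Thus `γ` is controlled by the `L^P` norms of `u` and
    -- `u - γ`.
    set T : ℝ≥0∞ := μ univ ^ (1 / q.toReal - 1 / P.toReal) with hT
    set T' : ℝ≥0∞ := μ univ ^ (1 / P.toReal - 1 / q.toReal) with hT'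
    have hTtop : T ≠ ∞ := ENNReal.rpow_ne_top_of_ne_zero hM0 hM.ne
    have hTtop' : T' ≠ ∞ := ENNReal.rpow_ne_top_of_ne_zero hM0 hM.ne
    have hLq : ENNReal.LpAddConst q ≠ ∞ := (ENNReal.LpAddConst_lt_top q).ne
    have hLP : ENNReal.LpAddConst P ≠ ∞ := (ENNReal.LpAddConst_lt_top P).ne
    have hP0 : P ≠ 0 := by simpa [hP] using hp
    have hq0' : q ≠ 0 := by simpa [hq] using hq0
    set A : ℝ≥0∞ := ENNReal.LpAddConst q * (1 + T * (ENNReal.LpAddConst P * T')) * ENNReal.ofReal C with hA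
    set B : ℝ≥0∞ := ENNReal.LpAddConst q * (T * ENNReal.LpAddConst P) with hB
    have hAtop : A ≠ ∞ := by rw [hA]; finiteness
    have hBtop : B ≠ ∞ := by rw [hB]; finiteness
    have hBd : B * ediam (univ : Set X) ≠ ∞ := ENNReal.mul_ne_top hBtop hd
    have hd0 : ediam (univ : Set X) ≠ 0 := ediam_univ_pos.ne'
    -- The summand `B * ediam` compensates the division by the diameter in the zero-order term.
    refine ⟨p, A.toReal + (B * ediam (univ : Set X)).toReal + 1, hp, hpQ, by positivity,
      fun u hu _ => ?_⟩
    have hmain : eLpNorm u q μ ≤ A * hajlaszSeminorm μ p u + B * eLpNorm u P μ := by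
      refine le_mul_add_of_forall_lt hAtop hu.2 (fun N hN hS => ?_)
      obtain ⟨γ, hγ⟩ := key N u hN hS
      have hum : AEStronglyMeasurable u μ := hu.1.aestronglyMeasurable
      have hvm : AEStronglyMeasurable (fun x => u x - γ) μ := (hu.1.sub_const γ).aestronglyMeasurable
      have h1 : eLpNorm u q μ ≤
          ENNReal.LpAddConst q * (eLpNorm (fun x => u x - γ) q μ + eLpNorm (fun _ : X => γ) q μ) := by
        have := eLpNorm_add_le' hvm (aestronglyMeasurable_const (b := γ)) q
        simpa [Pi.add_def] using this
      have h2 : eLpNorm (fun _ : X => γ) q μ = T * eLpNorm (fun _ : X => γ) P μ := by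
        rw [eLpNorm_const' _ hq0' ENNReal.ofReal_ne_top,
          eLpNorm_const' _ hP0 ENNReal.ofReal_ne_top, mul_left_comm, hT,
          ← ENNReal.rpow_add _ _ hM0 hM.ne, sub_add_cancel]
      have h3 : eLpNorm (fun _ : X => γ) P μ ≤
          ENNReal.LpAddConst P * (eLpNorm u P μ + eLpNorm (fun x => u x - γ) P μ) := by
        have := eLpNorm_add_le' hum hvm.neg P
        rw [eLpNorm_neg] at this
        simpa [Pi.add_def] using this
      have h4 : eLpNorm (fun x => u x - γ) P μ ≤ eLpNorm (fun x => u x - γ) q μ * T' :=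
        eLpNorm_le_eLpNorm_mul_rpow_measure_univ hPq hvm
      calc eLpNorm u q μ ≤ ENNReal.LpAddConst q * (eLpNorm (fun x => u x - γ) q μ + T *
            (ENNReal.LpAddConst P * (eLpNorm u P μ + eLpNorm (fun x => u x - γ) q μ * T'))) := by
            refine h1.trans ?_
            rw [h2]
            gcongr
            exact h3.trans (by gcongr)
        _ = ENNReal.LpAddConst q * (1 + T * (ENNReal.LpAddConst P * T')) * eLpNorm (fun x => u x - γ) q μ +
            B * eLpNorm u P μ := by rw [hB]; ring
        _ ≤ ENNReal.LpAddConst q * (1 + T * (ENNReal.LpAddConst P * T')) *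
            (ENNReal.ofReal C * ENNReal.ofReal N) + B * eLpNorm u P μ := by gcongr
        _ = _ := by rw [hA]; ring
    have hA' : A ≤ ENNReal.ofReal (A.toReal + (B * ediam (univ : Set X)).toReal + 1) := by
      rw [← ENNReal.ofReal_toReal hAtop]
      refine ENNReal.ofReal_le_ofReal ?_
      rw [ENNReal.ofReal_toReal hAtop]
      have : 0 ≤ (B * ediam (univ : Set X)).toReal := ENNReal.toReal_nonneg
      linarith
    have hB' : B ≤ ENNReal.ofReal (A.toReal + (B * ediam (univ : Set X)).toReal + 1) /
        ediam (univ : Set X) := by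
      rw [ENNReal.le_div_iff_mul_le (Or.inl hd0) (Or.inl hd)]
      rw [← ENNReal.ofReal_toReal hBd]
      refine ENNReal.ofReal_le_ofReal ?_
      rw [ENNReal.ofReal_toReal hBd]
      have : 0 ≤ A.toReal := ENNReal.toReal_nonneg
      linarith
    exact hmain.trans (by gcongr)

end Subcritical

/-! ### The case `p > Q`: Hölder continuity. -/

section Supercritical

variable {X : Type*} [MetricSpace X] [MeasurableSpace X] {μ : Measure X}

/-- Morrey-type pointwise estimate. -/
lemma exists_abs_sub_le_of_gt {p Q κ : ℝ} (hQ : 0 < Q) (hpQ : Q < p) (hκ0 : 0 < κ)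
    (hκ : ∀ (x : X) (r : ℝ), 0 < r → ENNReal.ofReal r ≤ ediam (univ : Set X) →
      ENNReal.ofReal (κ * r ^ Q) ≤ μ (ball x r)) :
    ∃ C : ℝ, 0 < C ∧ ∀ (N : ℝ) (u g : X → ℝ) (E : Set X), 0 < N → AEMeasurable g μ →
      eLpNorm g (ENNReal.ofReal p) μ < ENNReal.ofReal N → μ E = 0 →
      (∀ x ∉ E, ∀ y ∉ E, |u x - u y| ≤ dist x y * (g x + g y)) →
      ∀ x ∉ E, ∀ y ∉ E, |u x - u y| ≤ C * dist x y ^ (1 - Q / p) * N := by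
  have hp : 0 < p := hQ.trans hpQ
  set σ : ℝ := (2 : ℝ) ^ (1 - p / Q) with hσ
  have hσ0 : 0 < σ := by positivity
  have hσ1 : σ < 1 := Real.rpow_lt_one_of_one_lt_of_neg one_lt_two
    (by rw [sub_neg, one_lt_div hQ]; exact hpQ)
  have hτ1 : (2 : ℝ) ^ (-(p / Q)) < 1 :=
    Real.rpow_lt_one_of_one_lt_of_neg one_lt_two (by simp; positivity)
  have hσinv : 0 < (1 - σ)⁻¹ := inv_pos.2 (by linarith)
  have hτinv : 0 < (1 - (2 : ℝ) ^ (-(p / Q)))⁻¹ := inv_pos.2 (by linarith)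
  have hgeo : ∀ n : ℕ, ∑ j ∈ Finset.range n, σ ^ j ≤ (1 - σ)⁻¹ := fun n => by
    rw [← tsum_geometric_of_lt_one hσ0.le hσ1]
    exact (summable_geometric_of_lt_one hσ0.le hσ1).sum_le_tsum _ (fun _ _ => by positivity)
  set D : ℝ := 3 * ((1 - σ)⁻¹ + (1 - σ)⁻¹) + 4 * (1 + (1 - (2 : ℝ) ^ (-(p / Q)))⁻¹) with hD
  refine ⟨κ ^ (-(1 / p)) * D, by positivity, ?_⟩
  intro N u g E hN hg hgN hE hEu x hx y hy
  rcases eq_or_ne x y with rfl | hxy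
  · rw [sub_self, abs_zero]; positivity
  -- The chain starts at the scale `R = dist x y`; as `σ < 1`, its length no longer matters and no
  -- trace of `g x`, `g y` remains.
  have hR : 0 < dist x y := dist_pos.2 hxy
  have hRd : ENNReal.ofReal (dist x y) ≤ ediam (univ : Set X) := by
    rw [← edist_dist]; exact edist_le_ediam_of_mem (mem_univ x) (mem_univ y)
  have hs0 : 0 < chainLevel κ p Q N (dist x y) := chainLevel_pos hκ0 hN hR
  obtain ⟨k, hk, -⟩ := exists_two_pow_near (g x / chainLevel κ p Q N (dist x y))
  obtain ⟨l, hl, -⟩ := exists_two_pow_near (g y / chainLevel κ p Q N (dist x y))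
  have key := abs_sub_le_of_chain hp hQ hκ hs0 hN hg hgN hE hEu hR hRd
    (div_chainLevel_rpow hκ0 hN hR hp) hx hy (by linarith) ((div_le_iff₀ hs0).1 hk)
    ((div_le_iff₀ hs0).1 hl)
  calc |u x - u y| ≤ _ := key
    _ ≤ chainLevel κ p Q N (dist x y) * dist x y * D := by
      rw [hD]
      gcongr
      exacts [hgeo k, hgeo l]
    _ = _ := by rw [chainLevel_mul hκ0 hR]; ring

/-- McShane extension for Hölder functions. -/
lemma exists_holder_extension {Y : Type*} [MetricSpace Y] {G : Set Y} (hG : G.Nonempty)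
    {f : Y → ℝ} {K α : ℝ} (hK : 0 ≤ K) (hα : 0 < α) (hα1 : α ≤ 1)
    (hf : ∀ x ∈ G, ∀ y ∈ G, |f x - f y| ≤ K * dist x y ^ α) :
    ∃ v : Y → ℝ, (∀ x ∈ G, v x = f x) ∧ ∀ x y, |v x - v y| ≤ K * dist x y ^ α := by
  have : Nonempty G := hG.to_subtype
  have htri : ∀ x y z : Y, K * dist x z ^ α ≤ K * dist x y ^ α + K * dist y z ^ α := by
    intro x y z
    rw [← mul_add]
    gcongr
    calc dist x z ^ α ≤ (dist x y + dist y z) ^ α := by gcongr; exact dist_triangle _ _ _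
      _ ≤ _ := Real.rpow_add_le_add_rpow dist_nonneg dist_nonneg hα.le hα1
  have hbdd : ∀ x : Y, BddBelow (range fun z : G => f z + K * dist x z ^ α) := by
    intro x
    obtain ⟨w, hw⟩ := hG
    refine ⟨f w - K * dist w x ^ α, ?_⟩
    rintro _ ⟨z, rfl⟩
    have h1 := le_abs_self (f w - f z)
    have h2 := hf w hw z z.2
    have h3 := htri w x z
    simp only
    linarith
  set v : Y → ℝ := fun x => ⨅ z : G, (f z + K * dist x z ^ α) with hv
  have hle : ∀ x y, v x - v y ≤ K * dist x y ^ α := by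
    intro x y
    rw [sub_le_iff_le_add, ← sub_le_iff_le_add']
    refine le_ciInf fun z => ?_
    have h1 : v x ≤ f z + K * dist x z ^ α := ciInf_le (hbdd x) z
    linarith [htri x y z]
  refine ⟨v, fun x hx => ?_, fun x y => abs_sub_le_iff.2 ⟨hle x y, ?_⟩⟩
  · refine le_antisymm ?_ (le_ciInf fun z => ?_)
    · simpa [Real.zero_rpow hα.ne'] using ciInf_le (hbdd x) ⟨x, hx⟩
    · linarith [le_abs_self (f x - f z), hf x hx z z.2]
  · rw [dist_comm]; exact hle y x

lemma LowerAhlforsRegular.globalHolder [Nonempty X] {Q : ℝ} (hQ : 0 < Q)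
    (hμ : BallsPosFinite μ) (h : LowerAhlforsRegular μ Q) : GlobalHolder μ Q := by
  obtain ⟨p, hpQ⟩ : ∃ p : ℝ, Q < p := exists_gt Q
  have hp : 0 < p := hQ.trans hpQ
  obtain ⟨κ, hκ0, hκ⟩ := h
  obtain ⟨C, hC, key⟩ := exists_abs_sub_le_of_gt hQ hpQ hκ0 hκ
  refine ⟨p, C, hp, hpQ, hC, fun u hu => ?_⟩
  set S := (hajlaszSeminorm μ p u).toReal with hS
  have hS0 : 0 ≤ S := ENNReal.toReal_nonneg
  -- Each near-optimal gradient has its own exceptional set; a sequence of them costs only a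
  -- countable union of null sets.
  have hex : ∀ n : ℕ, ∃ E : Set X, μ E = 0 ∧ ∀ x ∉ E, ∀ y ∉ E,
      |u x - u y| ≤ C * dist x y ^ (1 - Q / p) * (S + 1 / ((n : ℝ) + 1)) := by
    intro n
    have hn : (0 : ℝ) < 1 / ((n : ℝ) + 1) := by positivity
    have hlt : hajlaszSeminorm μ p u < ENNReal.ofReal (S + 1 / ((n : ℝ) + 1)) := by
      rw [← ENNReal.ofReal_toReal hu.2.ne, ← hS]
      exact (ENNReal.ofReal_lt_ofReal_iff (by positivity)).2 (by linarith)
    obtain ⟨g, ⟨hg, hg0, E, hE, hEu⟩, hgN⟩ := exists_gradient_of_hajlaszSeminorm_lt hlt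
    exact ⟨E, hE, key _ u g E (by positivity) hg hgN hE hEu⟩
  choose E hE hEu using hex
  have hE' : μ (⋃ n, E n) = 0 := measure_iUnion_null hE
  have hGu : ∀ x ∈ (⋃ n, E n)ᶜ, ∀ y ∈ (⋃ n, E n)ᶜ,
      |u x - u y| ≤ C * S * dist x y ^ (1 - Q / p) := by
    intro x hx y hy
    simp only [mem_compl_iff, mem_iUnion, not_exists] at hx hy
    have hlim : Filter.Tendsto (fun n : ℕ => C * dist x y ^ (1 - Q / p) *
        (S + 1 / ((n : ℝ) + 1))) Filter.atTop (nhds (C * dist x y ^ (1 - Q / p) * (S + 0))) :=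
      (tendsto_const_nhds.add tendsto_one_div_add_atTop_nhds_zero_nat).const_mul _
    have := ge_of_tendsto' hlim (fun n => hEu n x (hx n) y (hy n))
    linarith
  have hne : ((⋃ n, E n)ᶜ).Nonempty := by
    by_contra hcon
    rw [not_nonempty_iff_eq_empty, compl_empty_iff] at hcon
    obtain ⟨x⟩ := ‹Nonempty X›
    exact (hμ x 1 one_pos).1.ne' (measure_mono_null (subset_univ _) (hcon ▸ hE'))
  have hQp : 0 < Q / p := by positivity
  obtain ⟨v, hvu, hv⟩ := exists_holder_extension hne (mul_nonneg hC.le hS0)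
    (by rw [sub_pos, div_lt_one hp]; exact hpQ) (by linarith) hGu
  refine ⟨v, ?_, fun x y => (hv x y).trans (by linarith)⟩
  filter_upwards [compl_mem_ae_iff.2 hE'] with x hx using hvu x hx

end Supercritical

/-! ### The case `p = Q`: exponential integrability. -/

section Critical

lemma lintegral_ofReal_div_rpow_le {α : Type*} [MeasurableSpace α] {ν : Measure α}
    {p N s : ℝ} {g : α → ℝ} (hp : 0 < p) (hs : 0 < s) (hN : 0 < N) (hg : ∀ x, 0 ≤ g x)
    (hgN : eLpNorm g (ENNReal.ofReal p) ν < ENNReal.ofReal N) :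
    ∫⁻ x, ENNReal.ofReal ((g x / s) ^ p) ∂ν ≤ ENNReal.ofReal ((N / s) ^ p) := by
  have h1 : eLpNorm (fun x => s⁻¹ * g x) (ENNReal.ofReal p) ν ≤ ENNReal.ofReal (N / s) := by
    have := eLpNorm_const_smul (p := ENNReal.ofReal p) (μ := ν) s⁻¹ g
    simp only [Pi.smul_def, smul_eq_mul] at this
    rw [this, Real.enorm_eq_ofReal (by positivity), div_eq_inv_mul,
      ENNReal.ofReal_mul (by positivity)]
    gcongr
  rw [eLpNorm_eq_lintegral_rpow_enorm_toReal (by simpa using hp) ENNReal.ofReal_ne_top,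
    ENNReal.toReal_ofReal hp.le, one_div, ENNReal.rpow_inv_le_iff hp,
    ENNReal.ofReal_rpow_of_pos (by positivity)] at h1
  refine le_trans (le_of_eq (lintegral_congr fun x => ?_)) h1
  have hx : 0 ≤ s⁻¹ * g x := mul_nonneg (by positivity) (hg x)
  rw [Real.enorm_eq_ofReal hx, ENNReal.ofReal_rpow_of_nonneg hx hp.le, div_eq_inv_mul]

/-- Allows the constant found by chaining to be replaced by the average over the ball, at the cost
of the mean bound `M`. -/
lemma integrableOn_and_abs_setAverage_sub_le {α : Type*} [MeasurableSpace α] {ν : Measure α}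
    {B : Set α} (hB0 : ν B ≠ 0) (hB : ν B ≠ ∞) {u H : α → ℝ} {γ M : ℝ} (hu : AEMeasurable u ν)
    (hH : IntegrableOn H B ν) (huH : ∀ᵐ x ∂ν.restrict B, |u x - γ| ≤ H x)
    (hM : ∫ x in B, H x ∂ν ≤ M * ν.real B) :
    IntegrableOn u B ν ∧ |⨍ x in B, u x ∂ν - γ| ≤ M := by
  have hB' : 0 < ν.real B := ENNReal.toReal_pos hB0 hB
  have hc : IntegrableOn (fun _ => γ) B ν := integrableOn_const hB
  have hsub : IntegrableOn (fun x => u x - γ) B ν :=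
    Integrable.mono' hH (hu.restrict.sub_const γ).aestronglyMeasurable huH
  have hint : IntegrableOn u B ν := by
    have := hsub.add hc
    simpa [Pi.add_def] using this
  refine ⟨hint, ?_⟩
  have h1 : ⨍ x in B, u x ∂ν - γ = (ν.real B)⁻¹ * ∫ x in B, (u x - γ) ∂ν := by
    rw [setAverage_eq, integral_sub hint hc, setIntegral_const, smul_eq_mul, smul_eq_mul, mul_sub,
      inv_mul_cancel_left₀ hB'.ne']
  have h2 : |∫ x in B, (u x - γ) ∂ν| ≤ M * ν.real B :=
    (norm_integral_le_of_norm_le (f := fun x => u x - γ) hH huH).trans hM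
  rw [h1, abs_mul, abs_of_pos (inv_pos.2 hB'), inv_mul_le_iff₀ hB', mul_comm (ν.real B)]
  exact h2

variable {X : Type*} [MetricSpace X] [MeasurableSpace X] {μ : Measure X}

lemma log_max_one_le {t Q : ℝ} (ht : 0 ≤ t) (hQ : 0 < Q) : Real.log (max 1 t) ≤ t ^ Q / Q := by
  rcases max_cases 1 t with ⟨h, _⟩ | ⟨h, _⟩ <;> rw [h]
  · rw [Real.log_one]; positivity
  · exact Real.log_le_rpow_div ht hQ

/-- Critical pointwise estimate on a ball. -/
lemma exists_const_abs_sub_le_log {Q κ N r : ℝ} {z : X} {u g : X → ℝ} {E : Set X} (hQ : 0 < Q)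
    (hκ0 : 0 < κ)
    (hκ : ∀ (x : X) (r : ℝ), 0 < r → ENNReal.ofReal r ≤ ediam (univ : Set X) →
      ENNReal.ofReal (κ * r ^ Q) ≤ μ (ball x r))
    (hr : 0 < r) (hrd : ENNReal.ofReal r ≤ ediam (univ : Set X)) (hN : 0 < N)
    (hg : AEMeasurable g μ)
    (hgN : eLpNorm g (ENNReal.ofReal Q) μ < ENNReal.ofReal N) (hE : μ E = 0)
    (hEu : ∀ x ∉ E, ∀ y ∉ E, |u x - u y| ≤ dist x y * (g x + g y)) :
    ∃ γ : ℝ, ∀ x ∈ ball z r \ E, |u x - γ| ≤ κ ^ (-(1 / Q)) * N *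
      (9 + 6 * Real.log (max 1 (g x / chainLevel κ Q Q N r))) := by
  set s := chainLevel κ Q Q N r with hs
  have hs0 : 0 < s := chainLevel_pos hκ0 hN hr
  have hsr : s * r = κ ^ (-(1 / Q)) * N := by
    rw [hs, chainLevel_mul hκ0 hr, div_self hQ.ne', sub_self, Real.rpow_zero, mul_one]
  refine exists_const_of_abs_sub_le fun x hx y hy => ?_
  have hlev : ∀ x, ∃ k : ℕ, g x ≤ 2 ^ k * s ∧
      -- Taking logarithms in `2 ^ k ≤ 2 * max 1 (g x / s)` and using `log 2 > 1 / 2`.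
      (k : ℝ) ≤ 1 + 2 * Real.log (max 1 (g x / s)) := by
    intro x
    obtain ⟨k, hk, hk'⟩ := exists_two_pow_near (g x / s)
    refine ⟨k, (div_le_iff₀ hs0).1 hk, ?_⟩
    have h1 := Real.log_le_log (by positivity) hk'
    have h0 : 0 ≤ Real.log (max 1 (g x / s)) := Real.log_nonneg (le_max_left _ _)
    rw [Real.log_pow, Real.log_mul two_ne_zero (by positivity)] at h1
    have h2 := Real.log_two_gt_d9
    by_contra! hcon
    nlinarith
  obtain ⟨k, hk, hk'⟩ := hlev x
  obtain ⟨l, hl, hl'⟩ := hlev y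
  have hxy : dist x y ≤ 2 * r := by
    have h1 := mem_ball.1 hx.1
    have h2 := mem_ball.1 hy.1
    have h3 := dist_triangle_right x y z
    linarith
  have key := abs_sub_le_of_chain hQ hQ hκ hs0 hN hg hgN hE hEu hr hrd
    (div_chainLevel_rpow hκ0 hN hr hQ) hx.2 hy.2 hxy hk hl
  rw [hsr, div_self hQ.ne', sub_self, Real.rpow_zero, Real.rpow_neg_one] at key
  simp only [one_pow, Finset.sum_const, Finset.card_range, nsmul_eq_mul, mul_one] at key
  refine key.trans ?_
  rw [← mul_add]
  refine mul_le_mul_of_nonneg_left ?_ (by positivity)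
  norm_num
  linarith

lemma LowerAhlforsRegular.globalTrudinger [OpensMeasurableSpace X] {Q : ℝ} (hQ : 0 < Q)
    (hμ : BallsPosFinite μ) (h : LowerAhlforsRegular μ Q) : GlobalTrudinger μ Q := by
  obtain ⟨κ, hκ0, hκ⟩ := h
  set m : ℝ := κ ^ (-(1 / Q)) with hm
  have hm0 : 0 < m := by positivity
  -- With `N` twice the seminorm, `Q / (12 m)` turns the bound `m N (18 + 6 / Q + 6 log)` into the
  -- exponent `3 Q + 1 + Q log`, so the exponential is at most `exp (3 Q + 1) (1 + t ^ Q)`; both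
  -- summands have mean at most `1`.
  refine ⟨Q / (12 * m), 2 * Real.exp (3 * Q + 1), 1, by positivity, by positivity, one_pos, ?_⟩
  intro z r hr hrd u hu _
  set B := ball z r with hB
  have hB0 : μ B ≠ 0 := (hμ z r hr).1.ne'
  have hBtop : μ B ≠ ∞ := (hμ z r hr).2.ne
  have hB' : 0 < μ.real B := ENNReal.toReal_pos hB0 hBtop
  have main : ∀ N : ℝ, 0 < N → hajlaszSeminorm μ Q u < ENNReal.ofReal N →
      IntegrableOn u B μ ∧ ∃ t : X → ℝ, AEMeasurable t μ ∧ (∀ x, 0 ≤ t x) ∧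
        ∫⁻ x in B, ENNReal.ofReal (t x ^ Q) ∂μ ≤ μ B ∧
        ∀ᵐ x ∂μ.restrict B, |u x - ⨍ y in B, u y ∂μ| ≤
          m * N * (18 + 6 / Q + 6 * Real.log (max 1 (t x))) := by
    intro N hN hS
    obtain ⟨g, ⟨hg, hg0, E, hE, hEu⟩, hgN⟩ := exists_gradient_of_hajlaszSeminorm_lt hS
    obtain ⟨γ, hγ⟩ := exists_const_abs_sub_le_log (z := z) hQ hκ0 hκ hr hrd hN hg hgN hE hEu
    set s := chainLevel κ Q Q N r with hs
    have hs0 : 0 < s := chainLevel_pos hκ0 hN hr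
    have hts : ∀ x, 0 ≤ g x / s := fun x => div_nonneg (hg0 x) hs0.le
    have htQ : ∫⁻ x in B, ENNReal.ofReal ((g x / s) ^ Q) ∂μ ≤ ENNReal.ofReal (κ * r ^ Q) := by
      calc _ ≤ ∫⁻ x, ENNReal.ofReal ((g x / s) ^ Q) ∂μ := setLIntegral_le_lintegral _ _
        _ ≤ ENNReal.ofReal ((N / s) ^ Q) := lintegral_ofReal_div_rpow_le hQ hs0 hN hg0 hgN
        _ = _ := by rw [hs, div_chainLevel_rpow hκ0 hN hr hQ]
    have htB : ∫⁻ x in B, ENNReal.ofReal ((g x / s) ^ Q) ∂μ ≤ μ B := htQ.trans (hκ z r hr hrd)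
    have hgm : AEMeasurable (fun x => (g x / s) ^ Q) μ := (hg.div_const s).pow_const Q
    have hae : ∀ᵐ x ∂μ.restrict B, x ∈ B \ E := by
      have h1 : ∀ᵐ x ∂μ.restrict B, x ∉ E := ae_restrict_of_ae (compl_mem_ae_iff.2 hE)
      have h2 : ∀ᵐ x ∂μ.restrict B, x ∈ B := by
        exact ae_restrict_mem measurableSet_ball
      filter_upwards [h1, h2] with x hx1 hx2 using ⟨hx2, hx1⟩
    have htint : IntegrableOn (fun x => (g x / s) ^ Q) B μ := by
      refine ⟨hgm.restrict.aestronglyMeasurable, ?_⟩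
      rw [hasFiniteIntegral_iff_ofReal (ae_of_all _ fun x => Real.rpow_nonneg (hts x) Q)]
      exact htB.trans_lt hBtop.lt_top
    have htreal : ∫ x in B, (g x / s) ^ Q ∂μ ≤ μ.real B := by
      rw [integral_eq_lintegral_of_nonneg_ae (ae_of_all _ fun x => Real.rpow_nonneg (hts x) Q)
        hgm.restrict.aestronglyMeasurable]
      exact ENNReal.toReal_mono hBtop htB
    have hcint : IntegrableOn (fun _ : X => (9 : ℝ)) B μ := integrableOn_const hBtop
    have hHint : Integrable (fun x => 6 / Q * (g x / s) ^ Q) (μ.restrict B) :=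
      htint.integrable.const_mul _
    -- For integrability the logarithm is weakened to `t ^ Q / Q`, whose integral over the ball is
    -- at most `μ B / Q` by the choice of level and lower regularity.
    obtain ⟨hint, havg⟩ := integrableOn_and_abs_setAverage_sub_le hB0 hBtop (γ := γ)
      (H := fun x => m * N * (9 + 6 / Q * (g x / s) ^ Q)) (M := m * N * (9 + 6 / Q)) hu.1
      ((hcint.add hHint).const_mul _)
      (by
        filter_upwards [hae] with x hx
        refine (hγ x hx).trans ?_
        have := log_max_one_le (hts x) hQ
        have h6 : 6 * Real.log (max 1 (g x / s)) ≤ 6 / Q * (g x / s) ^ Q := by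
          calc _ ≤ 6 * ((g x / s) ^ Q / Q) := by gcongr
            _ = _ := by ring
        gcongr)
      (by
        rw [integral_const_mul, integral_add hcint.integrable hHint,
          setIntegral_const, integral_const_mul, smul_eq_mul]
        calc _ ≤ m * N * (μ.real B * 9 + 6 / Q * μ.real B) := by gcongr
          _ = _ := by ring)
    refine ⟨hint, fun x => g x / s, hg.div_const s, hts, htB, ?_⟩
    filter_upwards [hae] with x hx
    have h1 := abs_sub_le (u x) γ (⨍ y in B, u y ∂μ)
    rw [abs_sub_comm γ] at h1
    linarith [hγ x hx]
  set S := hajlaszSeminorm μ Q u with hS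
  have hS0 : 0 ≤ S.toReal := ENNReal.toReal_nonneg
  have hlt : ∀ N : ℝ, S.toReal < N → S < ENNReal.ofReal N := fun N hN =>
    (ENNReal.lt_ofReal_iff_toReal_lt hu.2.ne).2 hN
  refine ⟨(main (S.toReal + 1) (by positivity) (hlt _ (by linarith))).1, ?_⟩
  rw [setLAverage_eq, ENNReal.div_le_iff hB0 hBtop]
  have hexp1 : (1 : ℝ) ≤ Real.exp (3 * Q + 1) := Real.one_le_exp (by positivity)
  rcases hS0.eq_or_lt with hS1 | hS1
  -- With zero seminorm the quotient is `0` by convention, so the integrand is `1`.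
  · simp only [← hS1, div_zero, mul_zero, Real.rpow_one, Real.exp_zero, ENNReal.ofReal_one]
    rw [setLIntegral_const, one_mul]
    refine le_mul_of_one_le_left zero_le ?_
    rw [← ENNReal.ofReal_one]
    exact ENNReal.ofReal_le_ofReal (by linarith)
  · obtain ⟨-, t, htm, ht0, htB, htu⟩ := main (2 * S.toReal) (by positivity)
      (hlt _ (by linarith))
    calc _ ≤ ∫⁻ x in B, ENNReal.ofReal (Real.exp (3 * Q + 1)) *
          (1 + ENNReal.ofReal (t x ^ Q)) ∂μ := by
          refine lintegral_mono_ae ?_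
          filter_upwards [htu] with x hx
          have htQ : 0 ≤ t x ^ Q := Real.rpow_nonneg (ht0 x) Q
          rw [← ENNReal.ofReal_one, ← ENNReal.ofReal_add zero_le_one htQ,
            ← ENNReal.ofReal_mul (by positivity), Real.rpow_one]
          refine ENNReal.ofReal_le_ofReal ?_
          calc _ ≤ Real.exp (3 * Q + 1 + Real.log (max 1 (t x)) * Q) := by
                refine Real.exp_le_exp.2 ?_
                calc _ ≤ Q / (12 * m) * (m * (2 * S.toReal) *
                      (18 + 6 / Q + 6 * Real.log (max 1 (t x))) / S.toReal) := by gcongr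
                  _ = _ := by field_simp; ring
            _ = Real.exp (3 * Q + 1) * (max 1 (t x)) ^ Q := by
                rw [Real.exp_add, Real.rpow_def_of_pos (by positivity)]
            _ ≤ _ := by
                gcongr
                rcases max_cases 1 (t x) with ⟨h, _⟩ | ⟨h, _⟩ <;> rw [h]
                · rw [Real.one_rpow]; linarith
                · linarith
      _ = ENNReal.ofReal (Real.exp (3 * Q + 1)) *
          (μ B + ∫⁻ x in B, ENNReal.ofReal (t x ^ Q) ∂μ) := by
          rw [lintegral_const_mul' _ _ ENNReal.ofReal_ne_top, lintegral_add_left measurable_const,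
            setLIntegral_const, one_mul]
      _ ≤ ENNReal.ofReal (Real.exp (3 * Q + 1)) * (μ B + μ B) := by gcongr
      _ = _ := by
          rw [mul_comm (2 : ℝ), ENNReal.ofReal_mul (by positivity), ENNReal.ofReal_ofNat]
          ring

end Critical

/-! ### De Giorgi iteration for measures of nested balls. -/

section Iteration

/-- De Giorgi iteration: a sequence with `a (j + 1) ≤ C b ^ j (a j) ^ θ` that stays away from zero
cannot start too small. -/
lemma exists_le_of_iterate_le {C b θ : ℝ} (hC : 0 < C) (hb : 1 ≤ b) (hθ : 1 < θ) :
    ∃ ε : ℝ, 0 < ε ∧ ∀ (a : ℕ → ℝ) (δ : ℝ), 0 < δ → (∀ j, δ ≤ a j) →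
      (∀ j, a (j + 1) ≤ C * b ^ j * a j ^ θ) → ε ≤ a 0 := by
  have hθ' : 0 < θ - 1 := by linarith
  have hb0 : 0 < b := by linarith
  -- The decay rate `l` absorbs the growth `b ^ j`, and `ε` is fixed by `C ε ^ (θ - 1) = l`, so that
  -- `a j ≤ ε l ^ j` reproduces itself. The factor `2` keeps `l < 1` even when `b = 1`.
  set l : ℝ := (2 * b) ^ (-(1 / (θ - 1))) with hl
  have hl0 : 0 < l := by positivity
  have hl1 : l < 1 := Real.rpow_lt_one_of_one_lt_of_neg (by linarith) (by simpa using hθ)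
  have hlb : b * l ^ (θ - 1) ≤ 1 := by
    rw [hl, ← Real.rpow_mul (by positivity)]
    have : -(1 / (θ - 1)) * (θ - 1) = -1 := by field_simp
    rw [this, Real.rpow_neg_one]
    rw [mul_inv, mul_left_comm, mul_inv_cancel₀ hb0.ne']
    norm_num
  set ε : ℝ := (l / C) ^ (1 / (θ - 1)) with hε
  have hε0 : 0 < ε := by positivity
  have hεC : C * ε ^ (θ - 1) = l := by
    rw [hε, ← Real.rpow_mul (by positivity)]
    have : 1 / (θ - 1) * (θ - 1) = 1 := by field_simp
    rw [this, Real.rpow_one, mul_div_cancel₀ _ hC.ne']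
  refine ⟨ε, hε0, fun a δ hδ hδa ha => ?_⟩
  by_contra! hlt
  have hind : ∀ j, a j ≤ ε * l ^ j := by
    intro j
    induction j with
    | zero => simpa using hlt.le
    | succ j ih =>
      have haj : 0 ≤ a j := hδ.le.trans (hδa j)
      have split : ∀ t : ℝ, 0 < t → t ^ θ = t * t ^ (θ - 1) := fun t ht => by
        rw [Real.rpow_sub_one ht.ne', mul_div_cancel₀ _ ht.ne']
      calc a (j + 1) ≤ C * b ^ j * a j ^ θ := ha j
        _ ≤ C * b ^ j * (ε * l ^ j) ^ θ := by gcongr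
        _ = ε * l ^ j * (C * ε ^ (θ - 1)) * (b * l ^ (θ - 1)) ^ j := by
          rw [split _ (by positivity), Real.mul_rpow hε0.le (by positivity), mul_pow b,
            ← Real.rpow_natCast_mul hl0.le, mul_comm (j : ℝ), Real.rpow_mul_natCast hl0.le]
          ring
        _ ≤ ε * l ^ j * l * 1 := by
          rw [hεC]
          gcongr
          exact pow_le_one₀ (by positivity) hlb
        _ = ε * l ^ (j + 1) := by ring
  have hlim : Filter.Tendsto (fun j : ℕ => ε * l ^ j) Filter.atTop (nhds (ε * 0)) :=
    (tendsto_pow_atTop_nhds_zero_of_lt_one hl0.le hl1).const_mul ε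
  have := ge_of_tendsto' hlim (fun j => (hδa j).trans (hind j))
  linarith

/-- Radii decreasing from `ρ` to `ρ / 2`. -/
noncomputable def nestedRadius (ρ : ℝ) (j : ℕ) : ℝ := ρ / 2 * (1 + (2 ^ j)⁻¹)

lemma nestedRadius_zero (ρ : ℝ) : nestedRadius ρ 0 = ρ := by
  norm_num [nestedRadius]

lemma half_lt_nestedRadius {ρ : ℝ} (hρ : 0 < ρ) (j : ℕ) : ρ / 2 < nestedRadius ρ j := by
  have : 0 < ρ / 2 * ((2 : ℝ) ^ j)⁻¹ := by positivity
  rw [nestedRadius]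
  linarith

lemma nestedRadius_pos {ρ : ℝ} (hρ : 0 < ρ) (j : ℕ) : 0 < nestedRadius ρ j := by
  unfold nestedRadius; positivity

lemma nestedRadius_le {ρ : ℝ} (hρ : 0 < ρ) (j : ℕ) : nestedRadius ρ j ≤ ρ := by
  have : ((2 : ℝ) ^ j)⁻¹ ≤ 1 := inv_le_one_of_one_le₀ (one_le_pow₀ one_le_two)
  rw [nestedRadius]
  nlinarith

lemma nestedRadius_sub (ρ : ℝ) (j : ℕ) :
    nestedRadius ρ j - nestedRadius ρ (j + 1) = ρ / (4 * 2 ^ j) := by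
  rw [nestedRadius, nestedRadius, pow_succ]
  field_simp
  ring

variable {X : Type*} [MetricSpace X] [MeasurableSpace X] {μ : Measure X}

lemma BallsPosFinite.real_pos (hμ : BallsPosFinite μ) (x : X) {r : ℝ} (hr : 0 < r) :
    0 < μ.real (ball x r) :=
  ENNReal.toReal_pos (hμ x r hr).1.ne' (hμ x r hr).2.ne

lemma BallsPosFinite.ofReal_real (hμ : BallsPosFinite μ) (x : X) {r : ℝ} (hr : 0 < r) :
    ENNReal.ofReal (μ.real (ball x r)) = μ (ball x r) :=
  ENNReal.ofReal_toReal (hμ x r hr).2.ne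

/-- All the nested balls contain the one of radius `ρ / 2`. Its measure is merely positive, but the
iteration uses no quantitative lower bound, so `ε` does not depend on `w` or `ρ`. -/
lemma exists_le_measure_of_nested_le (hμ : BallsPosFinite μ) {C b θ Q : ℝ} (hC : 0 < C)
    (hb : 1 ≤ b) (hθ : 1 < θ) :
    ∃ ε : ℝ, 0 < ε ∧ ∀ (w : X) (ρ : ℝ), 0 < ρ →
      (∀ j, μ.real (ball w (nestedRadius ρ (j + 1))) / ρ ^ Q ≤
        C * b ^ j * (μ.real (ball w (nestedRadius ρ j)) / ρ ^ Q) ^ θ) →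
      ENNReal.ofReal (ε * ρ ^ Q) ≤ μ (ball w ρ) := by
  obtain ⟨ε, hε, key⟩ := exists_le_of_iterate_le hC hb hθ
  refine ⟨ε, hε, fun w ρ hρ h => ?_⟩
  have hρQ : 0 < ρ ^ Q := by positivity
  have := key (fun j => μ.real (ball w (nestedRadius ρ j)) / ρ ^ Q)
    (μ.real (ball w (ρ / 2)) / ρ ^ Q) (div_pos (hμ.real_pos w (by positivity)) hρQ)
    (fun j => by
      gcongr
      · exact (hμ w _ (nestedRadius_pos hρ j)).2.ne
      · exact (half_lt_nestedRadius hρ j).le) h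
  simp only [nestedRadius_zero] at this
  rw [← hμ.ofReal_real w hρ]
  exact ENNReal.ofReal_le_ofReal ((le_div_iff₀ hρQ).1 this)

lemma exists_le_measure_of_sobolev (hμ : BallsPosFinite μ) {C p Q : ℝ} (hC : 0 < C)
    (hp : 0 < p) (hpQ : p < Q) :
    ∃ ε : ℝ, 0 < ε ∧ ∀ (w : X) (ρ : ℝ), 0 < ρ →
      (∀ j : ℕ, μ (ball w (nestedRadius ρ (j + 1))) ^ (1 / sobolevExponent Q p) ≤
        ENNReal.ofReal (C * (2 ^ j / ρ)) * μ (ball w (nestedRadius ρ j)) ^ (1 / p)) →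
      ENNReal.ofReal (ε * ρ ^ Q) ≤ μ (ball w ρ) := by
  set q := sobolevExponent Q p with hq
  have hq0 : 0 < q := sobolevExponent_pos hp hpQ
  have hQp : 0 < Q - p := by linarith
  have hpq : 1 < q / p := by
    rw [one_lt_div hp, hq, sobolevExponent, lt_div_iff₀ hQp]
    nlinarith
  -- The scaling identity of the Sobolev exponent: dividing the measures by `ρ ^ Q` removes `ρ` from
  -- the recursion.
  have hexp : q + Q = Q * (q / p) := by
    rw [hq, sobolevExponent]
    field_simp
    ring
  obtain ⟨ε, hε, key⟩ := exists_le_measure_of_nested_le (Q := Q) hμ (C := C ^ q)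
    (b := 2 ^ q) (by positivity) (Real.one_le_rpow one_le_two hq0.le) hpq
  refine ⟨ε, hε, fun w ρ hρ h => key w ρ hρ fun j => ?_⟩
  set m := μ.real (ball w (nestedRadius ρ j)) with hm
  set m' := μ.real (ball w (nestedRadius ρ (j + 1))) with hm'
  have hm0 : 0 < m := hμ.real_pos w (nestedRadius_pos hρ j)
  have hm0' : 0 < m' := hμ.real_pos w (nestedRadius_pos hρ (j + 1))
  have h1 : m' ^ (1 / q) ≤ C * (2 ^ j / ρ) * m ^ (1 / p) := by
    have := h j
    rw [← hμ.ofReal_real w (nestedRadius_pos hρ j),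
      ← hμ.ofReal_real w (nestedRadius_pos hρ (j + 1)), ENNReal.ofReal_rpow_of_pos hm0,
      ENNReal.ofReal_rpow_of_pos hm0', ← ENNReal.ofReal_mul (by positivity)] at this
    exact (ENNReal.ofReal_le_ofReal_iff (by positivity)).1 this
  have h2 := Real.rpow_le_rpow (by positivity) h1 hq0.le
  rw [← Real.rpow_mul hm0'.le, one_div, inv_mul_cancel₀ hq0.ne', Real.rpow_one,
    Real.mul_rpow (by positivity) (by positivity), Real.mul_rpow hC.le (by positivity),
    Real.div_rpow (by positivity) hρ.le, ← Real.rpow_mul hm0.le] at h2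
  have e1 : ((2 : ℝ) ^ j) ^ q = (2 ^ q) ^ j := by
    rw [← Real.rpow_natCast_mul two_pos.le, mul_comm, Real.rpow_mul_natCast two_pos.le]
  have e2 : ρ ^ q * ρ ^ Q = (ρ ^ Q) ^ (q / p) := by
    rw [← Real.rpow_add hρ, hexp, Real.rpow_mul hρ.le]
  rw [div_le_iff₀ (by positivity)]
  refine h2.trans (le_of_eq ?_)
  rw [e1, Real.div_rpow hm0.le (by positivity), ← e2, one_div_mul_eq_div]
  field_simp

end Iteration

/-! ### Lipschitz bumps as test functions. -/

section Bump

variable {X : Type*} [MetricSpace X]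

/-- The Lipschitz bump which is `1` on `ball x R'` and vanishes off `ball x R`. -/
noncomputable def bump (x : X) (R' R : ℝ) (y : X) : ℝ :=
  max 0 (min 1 ((R - dist y x) / (R - R')))

lemma bump_eq_one {x y : X} {R' R : ℝ} (hR : R' < R) (hy : y ∈ ball x R') : bump x R' R y = 1 := by
  have : 1 ≤ (R - dist y x) / (R - R') := by
    rw [one_le_div (by linarith)]
    linarith [mem_ball.1 hy]
  rw [bump, min_eq_left this, max_eq_right zero_le_one]

lemma bump_eq_zero {x y : X} {R' R : ℝ} (hR : R' < R) (hy : y ∉ ball x R) : bump x R' R y = 0 := by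
  have : (R - dist y x) / (R - R') ≤ 0 := by
    rw [mem_ball, not_lt] at hy
    exact div_nonpos_of_nonpos_of_nonneg (by linarith) (by linarith)
  rw [bump, max_eq_left ((min_le_right _ _).trans this)]

lemma bump_nonneg (x y : X) (R' R : ℝ) : 0 ≤ bump x R' R y := le_max_left _ _

lemma bump_le_one (x y : X) (R' R : ℝ) : bump x R' R y ≤ 1 :=
  max_le zero_le_one (min_le_left _ _)

lemma abs_bump_sub_le (x y z : X) {R' R : ℝ} (hR : R' < R) :
    |bump x R' R y - bump x R' R z| ≤ dist y z * (R - R')⁻¹ := by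
  have h0 : 0 < (R - R')⁻¹ := inv_pos.2 (by linarith)
  have h1 : |bump x R' R y - bump x R' R z| ≤
      |(R - dist y x) / (R - R') - (R - dist z x) / (R - R')| := by
    refine (abs_max_sub_max_le_max _ _ _ _).trans ?_
    rw [sub_self, abs_zero, max_eq_right (abs_nonneg _)]
    refine (abs_min_sub_min_le_max _ _ _ _).trans ?_
    rw [sub_self, abs_zero, max_eq_right (abs_nonneg _)]
  refine h1.trans ?_
  rw [← sub_div, div_eq_mul_inv, abs_mul, abs_of_pos h0]
  gcongr
  rw [sub_sub_sub_cancel_left, dist_comm y z]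
  exact abs_dist_sub_le z y x

lemma continuous_bump (x : X) (R' R : ℝ) : Continuous (bump x R' R) := by
  unfold bump; fun_prop

/-- A bump between the balls of radii `R' < R` about `w` is at distance at least `1 / 2` from any
constant on one of two given sets. -/
lemma half_le_abs_bump_sub {w : X} {R' R : ℝ} (hR : R' < R) {S : Set X}
    (hS : Disjoint (ball w R) S) (γ : ℝ) :
    (∀ y ∈ ball w R', 1 / 2 ≤ |bump w R' R y - γ|) ∨ (∀ y ∈ S, 1 / 2 ≤ |bump w R' R y - γ|) := by
  rcases le_total γ (1 / 2) with h | h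
  · left
    intro y hy
    rw [bump_eq_one hR hy]
    exact le_trans (by linarith) (le_abs_self _)
  · right
    intro y hy
    rw [bump_eq_zero hR (fun hy' => hS.notMem_of_mem_left hy' hy), zero_sub, abs_neg]
    exact h.trans (le_abs_self _)

variable [MeasurableSpace X] [OpensMeasurableSpace X] {μ : Measure X}

lemma isHajlaszGradient_bump (x : X) {R' R : ℝ} (hR : R' < R) :
    IsHajlaszGradient μ (bump x R' R) ((ball x R).indicator fun _ => (R - R')⁻¹) := by
  have h0 : 0 < (R - R')⁻¹ := inv_pos.2 (by linarith)
  have hnn : ∀ y, 0 ≤ (ball x R).indicator (fun _ => (R - R')⁻¹) y :=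
    fun y => indicator_nonneg (fun _ _ => h0.le) y
  refine ⟨(measurable_const.indicator measurableSet_ball).aemeasurable, hnn, ∅, by simp, ?_⟩
  intro y _ z _
  by_cases hy : y ∈ ball x R
  · refine (abs_bump_sub_le x y z hR).trans ?_
    gcongr
    rw [indicator_of_mem hy]
    linarith [hnn z]
  by_cases hz : z ∈ ball x R
  · refine (abs_bump_sub_le x y z hR).trans ?_
    gcongr
    rw [indicator_of_mem hz]
    linarith [hnn y]
  · rw [bump_eq_zero hR hy, bump_eq_zero hR hz, sub_self, abs_zero]
    exact mul_nonneg dist_nonneg (add_nonneg (hnn y) (hnn z))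

lemma hajlaszSeminorm_bump_le (x : X) {R' R p : ℝ} (hR : R' < R) (hp : 0 < p) :
    hajlaszSeminorm μ p (bump x R' R) ≤ ENNReal.ofReal (R - R')⁻¹ * μ (ball x R) ^ (1 / p) := by
  have h0 : 0 < (R - R')⁻¹ := inv_pos.2 (by linarith)
  refine (hajlaszSeminorm_le (isHajlaszGradient_bump x hR)).trans (le_of_eq ?_)
  rw [eLpNorm_indicator_const measurableSet_ball (by simpa using hp) ENNReal.ofReal_ne_top,
    ENNReal.toReal_ofReal hp.le, Real.enorm_eq_ofReal h0.le]

lemma memHajlasz_bump (hμ : BallsPosFinite μ) (x : X) {R' R p : ℝ} (hR0 : 0 < R) (hR : R' < R)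
    (hp : 0 < p) : MemHajlasz μ p (bump x R' R) := by
  refine ⟨(continuous_bump x R' R).measurable.aemeasurable,
    (hajlaszSeminorm_bump_le x hR hp).trans_lt (ENNReal.mul_lt_top ENNReal.ofReal_lt_top ?_)⟩
  exact ENNReal.rpow_lt_top_of_nonneg (by positivity) (hμ x R hR0).2.ne

lemma hajlaszSeminorm_bump_nestedRadius_le (x : X) {ρ p : ℝ} (hρ : 0 < ρ) (hp : 0 < p) (j : ℕ) :
    hajlaszSeminorm μ p (bump x (nestedRadius ρ (j + 1)) (nestedRadius ρ j)) ≤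
      ENNReal.ofReal (4 * (2 ^ j / ρ)) * μ (ball x (nestedRadius ρ j)) ^ (1 / p) := by
  have h := nestedRadius_sub ρ j
  have h0 : 0 < ρ / (4 * 2 ^ j) := by positivity
  have := hajlaszSeminorm_bump_le (μ := μ) x
    (show nestedRadius ρ (j + 1) < nestedRadius ρ j by linarith) hp
  rw [h, inv_div, mul_div_assoc] at this
  exact this

lemma eLpNorm_bump_le (x : X) {R' R p : ℝ} (hR : R' < R) (hp : 0 < p) :
    eLpNorm (bump x R' R) (ENNReal.ofReal p) μ ≤ μ (ball x R) ^ (1 / p) := by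
  calc _ ≤ eLpNorm ((ball x R).indicator fun _ => (1 : ℝ)) (ENNReal.ofReal p) μ := by
        refine eLpNorm_mono_real fun y => ?_
        rw [Real.norm_of_nonneg (bump_nonneg _ _ _ _)]
        by_cases hy : y ∈ ball x R
        · rw [indicator_of_mem hy]; exact bump_le_one _ _ _ _
        · rw [indicator_of_notMem hy, bump_eq_zero hR hy]
    _ = _ := by
        rw [eLpNorm_indicator_const measurableSet_ball (by simpa using hp) ENNReal.ofReal_ne_top,
          ENNReal.toReal_ofReal hp.le, enorm_one, one_mul]

lemma ofReal_mul_measure_rpow_le_eLpNorm {α : Type*} [MeasurableSpace α] {ν : Measure α}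
    {S : Set α} (hS : MeasurableSet S) {f : α → ℝ} {c q : ℝ} (hq : 0 < q) (hc : 0 ≤ c)
    (hf : ∀ x ∈ S, c ≤ |f x|) :
    ENNReal.ofReal c * ν S ^ (1 / q) ≤ eLpNorm f (ENNReal.ofReal q) ν := by
  have : eLpNorm (S.indicator fun _ => c) (ENNReal.ofReal q) ν =
      ENNReal.ofReal c * ν S ^ (1 / q) := by
    rw [eLpNorm_indicator_const hS (by simpa using hq) ENNReal.ofReal_ne_top,
      ENNReal.toReal_ofReal hq.le, Real.enorm_eq_ofReal hc]
  rw [← this]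
  refine eLpNorm_mono fun x => ?_
  by_cases hx : x ∈ S
  · rw [indicator_of_mem hx, Real.norm_of_nonneg hc]; exact hf x hx
  · rw [indicator_of_notMem hx, norm_zero]; exact norm_nonneg _

end Bump

/-! ### Disjoint balls and functions of zero seminorm. -/

section Preparation

variable {X : Type*} [MetricSpace X] [MeasurableSpace X] {μ : Measure X}

/-- In a uniformly perfect space every ball of radius at most the diameter contains two disjoint
balls of comparable radius. -/
lemma UniformlyPerfect.exists_disjoint_balls (h : UniformlyPerfect X) (μ : Measure X) :
    ∃ c : ℝ, 0 < c ∧ ∀ (x : X) (r : ℝ), 0 < r → ENNReal.ofReal r ≤ ediam (univ : Set X) →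
      ∃ w w' : X, ball w (c * r) ⊆ ball x r ∧ ball w' (c * r) ⊆ ball x r ∧
        Disjoint (ball w (c * r)) (ball w' (c * r)) ∧
        μ (ball w (c * r)) ≤ μ (ball w' (c * r)) := by
  obtain ⟨lam, h0, h1, h⟩ := h
  refine ⟨lam / 8, by positivity, fun x r hr hrd => ?_⟩
  -- If this ball were the whole space, the diameter would be at most `r / 2`. The point `y` then
  -- found has `lam * r / 4 ≤ dist y x < r / 4`, so balls of radius `lam * r / 8` about `x` and `y`
  -- are disjoint.
  have hne : ((univ : Set X) \ ball x (r / 4)).Nonempty := by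
    rw [sdiff_nonempty]
    intro hsub
    have : ediam (univ : Set X) ≤ ENNReal.ofReal (r / 2) := by
      refine ediam_le fun y hy z hz => ?_
      rw [edist_dist]
      refine ENNReal.ofReal_le_ofReal ?_
      have := mem_ball.1 (hsub hy)
      have := mem_ball.1 (hsub hz)
      linarith [dist_triangle_right y z x]
    have := (ENNReal.ofReal_le_ofReal_iff (by positivity)).1 (hrd.trans this)
    linarith
  obtain ⟨y, hy, hy'⟩ := h x (r / 4) (by positivity) hne
  rw [mem_ball] at hy
  rw [mem_ball, not_lt] at hy'
  have hlr : lam * r ≤ r := by nlinarith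
  have hx : ball x (lam / 8 * r) ⊆ ball x r := ball_subset_ball (by linarith)
  have hyx : ball y (lam / 8 * r) ⊆ ball x r := ball_subset_ball' (by linarith)
  have hdisj : Disjoint (ball x (lam / 8 * r)) (ball y (lam / 8 * r)) :=
    ball_disjoint_ball (by rw [dist_comm]; linarith)
  rcases le_total (μ (ball x (lam / 8 * r))) (μ (ball y (lam / 8 * r))) with hle | hle
  · exact ⟨x, y, hx, hyx, hdisj, hle⟩
  · exact ⟨y, x, hyx, hx, hdisj.symm, hle⟩

lemma exists_mem_of_ae {α : Type*} [MeasurableSpace α] {ν : Measure α} {S : Set α} (hS : 0 < ν S)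
    {P : α → Prop} (hP : ∀ᵐ x ∂ν, P x) : ∃ x ∈ S, P x := by
  by_contra! hcon
  exact hS.ne' (measure_mono_null hcon hP)

/-- Gradients tending to zero in `L^p` tend to zero almost everywhere along a subsequence; the
gradient inequality against one good point passes to the limit. -/
lemma exists_ae_eq_const_of_hajlaszSeminorm_eq_zero {p : ℝ} (hp : 0 < p) {u : X → ℝ}
    (hu : hajlaszSeminorm μ p u = 0) : ∃ c : ℝ, ∀ᵐ x ∂μ, u x = c := by
  have hex : ∀ n : ℕ, ∃ g, IsHajlaszGradient μ u g ∧
      eLpNorm g (ENNReal.ofReal p) μ < ((n : ℝ≥0∞) + 1)⁻¹ := fun n =>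
    exists_gradient_of_hajlaszSeminorm_lt (by rw [hu]; simp)
  choose g hg hgn using hex
  choose hgm hg0 E hE hEu using hg
  have hlim : Filter.Tendsto (fun n => eLpNorm (g n - 0) (ENNReal.ofReal p) μ) Filter.atTop
      (nhds 0) := by
    have h1 : Filter.Tendsto (fun n : ℕ => ((n : ℝ≥0∞) + 1)⁻¹) Filter.atTop (nhds 0) := by
      have := (Filter.tendsto_add_atTop_iff_nat 1).2 ENNReal.tendsto_inv_nat_nhds_zero
      simpa using this
    refine tendsto_of_tendsto_of_tendsto_of_le_of_le tendsto_const_nhds h1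
      (fun n => zero_le) (fun n => ?_)
    simpa using (hgn n).le
  obtain ⟨ns, -, hns⟩ := (tendstoInMeasure_of_tendsto_eLpNorm (by simpa using hp)
    (fun n => (hgm n).aestronglyMeasurable) aestronglyMeasurable_zero
    hlim).exists_seq_tendsto_ae
  have hall : ∀ᵐ x ∂μ, ∀ n, x ∉ E n := ae_all_iff.2 fun n => compl_mem_ae_iff.2 (hE n)
  by_cases hμ0 : μ = 0
  · exact ⟨0, by simp [hμ0]⟩
  obtain ⟨x₀, -, hx₀, hx₀'⟩ := exists_mem_of_ae (S := univ)
    (by rwa [pos_iff_ne_zero, Ne, Measure.measure_univ_eq_zero]) (hall.and hns)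
  refine ⟨u x₀, ?_⟩
  filter_upwards [hall, hns] with x hx hx'
  have h1 : Filter.Tendsto (fun i => dist x x₀ * (g (ns i) x + g (ns i) x₀)) Filter.atTop
      (nhds (dist x x₀ * (0 + 0))) := (hx'.add hx₀').const_mul _
  have h2 := ge_of_tendsto' h1 fun i => hEu (ns i) x (hx _) x₀ (hx₀ _)
  rw [add_zero, mul_zero] at h2
  exact sub_eq_zero.1 (abs_nonpos_iff.1 h2)

end Preparation

/-! ### From each embedding back to lower regularity. -/

section Necessity

variable {X : Type*} [MetricSpace X] [MeasurableSpace X] [OpensMeasurableSpace X] {μ : Measure X}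

lemma GlobalSobolev.lowerAhlforsRegular {Q : ℝ} (hμ : BallsPosFinite μ)
    (h : GlobalSobolev μ Q) : LowerAhlforsRegular μ Q := by
  obtain ⟨p, C, hp, hpQ, hC, h⟩ := h
  -- `4 C` comes from the gradient of the bump and `C` from the zero-order term, where `1 / diam ≤ 1
  -- / r ≤ 2 ^ j / r`.
  obtain ⟨ε, hε, key⟩ := exists_le_measure_of_sobolev hμ (C := 5 * C) (by positivity) hp hpQ
  refine ⟨ε, hε, fun x r hr hrd => key x r hr fun j => ?_⟩
  set R := nestedRadius r j with hRdef
  set R' := nestedRadius r (j + 1) with hRdef'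
  have hR0 : 0 < R := nestedRadius_pos hr j
  have hR : R' < R := by
    have := nestedRadius_sub r j
    have h0 : 0 < r / (4 * 2 ^ j) := by positivity
    linarith
  have hLp := eLpNorm_bump_le (μ := μ) x hR hp
  have hq0 := sobolevExponent_pos hp hpQ
  have hB : μ (ball x R) ^ (1 / p) < ∞ :=
    ENNReal.rpow_lt_top_of_nonneg (by positivity) (hμ x R hR0).2.ne
  have h1 := h (bump x R' R) (memHajlasz_bump hμ x hR0 hR hp) fun _ => hLp.trans_lt hB
  have h2 := ofReal_mul_measure_rpow_le_eLpNorm (ν := μ) (S := ball x R') (f := bump x R' R)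
    measurableSet_ball hq0 zero_le_one (fun y hy => by rw [bump_eq_one hR hy, abs_one])
  rw [ENNReal.ofReal_one, one_mul] at h2
  have h3 : ENNReal.ofReal C / ediam (univ : Set X) ≤ ENNReal.ofReal (C * (2 ^ j / r)) := by
    calc _ ≤ ENNReal.ofReal C / ENNReal.ofReal r := by gcongr
      _ = ENNReal.ofReal (C / r) := (ENNReal.ofReal_div_of_pos hr).symm
      _ ≤ _ := by
        refine ENNReal.ofReal_le_ofReal ?_
        rw [mul_div_assoc']
        gcongr
        exact le_mul_of_one_le_right hC.le (one_le_pow₀ one_le_two)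
  calc _ ≤ _ := h2.trans h1
    _ ≤ ENNReal.ofReal C * (ENNReal.ofReal (4 * (2 ^ j / r)) * μ (ball x R) ^ (1 / p)) +
        ENNReal.ofReal (C * (2 ^ j / r)) * μ (ball x R) ^ (1 / p) := by
      gcongr
      exact hajlaszSeminorm_bump_nestedRadius_le x hr hp j
    _ = _ := by
      rw [← mul_assoc, ← ENNReal.ofReal_mul hC.le, ← add_mul, ← ENNReal.ofReal_add (by positivity)
        (by positivity)]
      congr 2
      ring

lemma GlobalSobolevPoincare.lowerAhlforsRegular {Q : ℝ} (hμ : BallsPosFinite μ)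
    (hX : UniformlyPerfect X) (h : GlobalSobolevPoincare μ Q) : LowerAhlforsRegular μ Q := by
  obtain ⟨p, C, hp, hpQ, hC, h⟩ := h
  have hq0 := sobolevExponent_pos hp hpQ
  obtain ⟨c, hc, hballs⟩ := hX.exists_disjoint_balls μ
  obtain ⟨ε, hε, key⟩ := exists_le_measure_of_sobolev hμ (C := 8 * C) (by positivity) hp hpQ
  refine ⟨ε * c ^ Q, by positivity, fun x r hr hrd => ?_⟩
  obtain ⟨w, w', hw, -, hdisj, hle⟩ := hballs x r hr hrd
  set ρ := c * r with hρdef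
  have hρ : 0 < ρ := by positivity
  have hmain : ENNReal.ofReal (ε * ρ ^ Q) ≤ μ (ball w ρ) := by
    refine key w ρ hρ fun j => ?_
    set R := nestedRadius ρ j with hRdef
    set R' := nestedRadius ρ (j + 1) with hRdef'
    have hR0 : 0 < R := nestedRadius_pos hρ j
    have hRρ : R ≤ ρ := nestedRadius_le hρ j
    have hR : R' < R := by
      have := nestedRadius_sub ρ j
      have h0 : 0 < ρ / (4 * 2 ^ j) := by positivity
      linarith
    have h1 : ENNReal.ofReal (1 / 2) * μ (ball w R') ^ (1 / sobolevExponent Q p) ≤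
        ⨅ γ : ℝ, eLpNorm (fun x => bump w R' R x - γ)
          (ENNReal.ofReal (sobolevExponent Q p)) μ := by
      refine le_iInf fun γ => ?_
      -- Either `γ` is far from `1`, the value on the small ball, or far from `0`, the value on the
      -- ball about `w'`, whose measure is no smaller.
      rcases half_le_abs_bump_sub hR (hdisj.mono_left (ball_subset_ball hRρ)) γ with hγ | hγ
      · exact ofReal_mul_measure_rpow_le_eLpNorm measurableSet_ball hq0 (by norm_num) hγ
      · refine le_trans ?_
          (ofReal_mul_measure_rpow_le_eLpNorm measurableSet_ball hq0 (by norm_num) hγ)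
        exact mul_le_mul' le_rfl (ENNReal.rpow_le_rpow
          ((measure_mono (ball_subset_ball (hR.le.trans hRρ))).trans hle) (by positivity))
    have h2 := h1.trans (h _ (memHajlasz_bump hμ w hR0 hR hp))
    have h3 := hajlaszSeminorm_bump_nestedRadius_le (μ := μ) w hρ hp j
    have h4 : ENNReal.ofReal 2 * ENNReal.ofReal (1 / 2) = 1 := by
      rw [← ENNReal.ofReal_mul two_pos.le]; norm_num
    calc _ = ENNReal.ofReal 2 * (ENNReal.ofReal (1 / 2) *
          μ (ball w R') ^ (1 / sobolevExponent Q p)) := by rw [← mul_assoc, h4, one_mul]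
      _ ≤ ENNReal.ofReal 2 * (ENNReal.ofReal C *
          (ENNReal.ofReal (4 * (2 ^ j / ρ)) * μ (ball w R) ^ (1 / p))) := by
        exact mul_le_mul' le_rfl (h2.trans (mul_le_mul' le_rfl h3))
      _ = _ := by
        rw [← mul_assoc, ← mul_assoc, ← ENNReal.ofReal_mul two_pos.le,
          ← ENNReal.ofReal_mul (by positivity)]
        congr 2
        ring
  rw [hρdef, Real.mul_rpow hc.le hr.le, ← mul_assoc, ← hρdef] at hmain
  exact hmain.trans (measure_mono hw)

/-- The bump drops from `1` to `0` within distance `2 r`, while its seminorm is at most `2 / ρ`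
times the measure to the power `1 / p`; comparing the two bounds the measure below without
iteration. -/
lemma GlobalHolder.lowerAhlforsRegular {Q : ℝ} (hμ : BallsPosFinite μ)
    (hX : UniformlyPerfect X) (h : GlobalHolder μ Q) : LowerAhlforsRegular μ Q := by
  obtain ⟨p, C, hp, hpQ, hC, h⟩ := h
  obtain ⟨c, hc, hballs⟩ := hX.exists_disjoint_balls μ
  have hexp : 0 < 1 - Q / p := by rw [sub_pos, div_lt_one hp]; exact hpQ
  set K : ℝ := C * 2 ^ (1 - Q / p) * (2 / c) with hK
  have hK0 : 0 < K := by positivity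
  refine ⟨(1 / K) ^ p, by positivity, fun x r hr hrd => ?_⟩
  obtain ⟨w, w', hw, hw', hdisj, -⟩ := hballs x r hr hrd
  set ρ := c * r with hρdef
  have hρ : 0 < ρ := by positivity
  have hR : ρ / 2 < ρ := by linarith
  obtain ⟨v, hvu, hv⟩ := h _ (memHajlasz_bump hμ w hρ hR hp)
  obtain ⟨y, hy, hvy⟩ := exists_mem_of_ae (hμ w (ρ / 2) (by positivity)).1 hvu
  obtain ⟨z, hz, hvz⟩ := exists_mem_of_ae (hμ w' ρ hρ).1 hvu
  have hS : (hajlaszSeminorm μ p (bump w (ρ / 2) ρ)).toReal ≤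
      2 / ρ * μ.real (ball w ρ) ^ (1 / p) := by
    have := hajlaszSeminorm_bump_le (μ := μ) w hR hp
    rw [← hμ.ofReal_real w hρ, ENNReal.ofReal_rpow_of_pos (hμ.real_pos w hρ),
      ← ENNReal.ofReal_mul (inv_nonneg.2 (by linarith)), sub_half, inv_div] at this
    exact ENNReal.toReal_le_of_le_ofReal
      (mul_nonneg (by positivity) (Real.rpow_nonneg measureReal_nonneg _)) this
  have hd : dist y z ≤ 2 * r := by
    have h1 := mem_ball.1 (hw (ball_subset_ball hR.le hy))
    have h2 := mem_ball.1 (hw' hz)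
    linarith [dist_triangle_right y z x]
  have h1 := hv y z
  rw [hvy, hvz, bump_eq_one hR hy,
    bump_eq_zero hR (fun hz' => hdisj.notMem_of_mem_left hz' hz), sub_zero, abs_one] at h1
  set m := μ.real (ball w ρ) with hm
  have hm0 : 0 < m := hμ.real_pos w hρ
  have h2 : 1 ≤ K * r ^ (-(Q / p)) * m ^ (1 / p) := by
    calc 1 ≤ C * (2 * r) ^ (1 - Q / p) * (2 / ρ * m ^ (1 / p)) := by
          refine h1.trans ?_
          gcongr
      _ = _ := by
          rw [hK, hρdef, Real.mul_rpow two_pos.le hr.le, sub_eq_add_neg 1 (Q / p),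
            Real.rpow_add hr, Real.rpow_one]
          field_simp
  have h3 : 1 / K * r ^ (Q / p) ≤ m ^ (1 / p) := by
    rw [Real.rpow_neg hr.le] at h2
    rw [one_div_mul_eq_div, div_le_iff₀ hK0]
    have h4 : 0 < r ^ (Q / p) := by positivity
    rw [mul_right_comm, ← div_eq_mul_inv, le_div_iff₀ h4] at h2
    linarith
  have h4 := Real.rpow_le_rpow (by positivity) h3 hp.le
  rw [Real.mul_rpow (by positivity) (by positivity), ← Real.rpow_mul hr.le,
    ← Real.rpow_mul hm0.le, div_mul_cancel₀ _ hp.ne', one_div_mul_cancel hp.ne',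
    Real.rpow_one] at h4
  refine (ENNReal.ofReal_le_ofReal h4).trans ?_
  rw [hm, hμ.ofReal_real w hρ]
  exact measure_mono hw

lemma rpow_le_mul_exp {z a : ℝ} (hz : 0 ≤ z) (ha : 0 < a) : z ^ a ≤ a ^ a * Real.exp z := by
  have h1 : z ≤ a * Real.exp (z / a) := by
    have := Real.add_one_le_exp (z / a)
    calc z = a * (z / a) := by field_simp
      _ ≤ _ := by gcongr; linarith
  calc z ^ a ≤ (a * Real.exp (z / a)) ^ a := by gcongr
    _ = _ := by
      rw [Real.mul_rpow ha.le (by positivity), ← Real.exp_mul, div_mul_cancel₀ _ ha.ne']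

lemma GlobalTrudinger.lowerAhlforsRegular {Q : ℝ} (hQ : 0 < Q) (hμ : BallsPosFinite μ)
    (hX : UniformlyPerfect X) (h : GlobalTrudinger μ Q) : LowerAhlforsRegular μ Q := by
  obtain ⟨c₁, c₂, ω, hc₁, hc₂, hω, h⟩ := h
  obtain ⟨c, hc, hballs⟩ := hX.exists_disjoint_balls μ
  -- Bounding the exponential below by its argument to the power `a` leaves `s ^ (-2 Q)`. Since `s`
  -- is controlled by the measure to the power `1 / Q`, the recursion is quadratic, `θ = 2`.
  set a : ℝ := 2 * Q / ω with ha
  have ha0 : 0 < a := by positivity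
  set D : ℝ := a ^ a * c₂ * (8 / c₁) ^ (2 * Q) / c ^ Q with hD
  have hD0 : 0 < D := by positivity
  obtain ⟨ε, hε, key⟩ := exists_le_measure_of_nested_le (Q := Q) hμ (C := D)
    (b := 2 ^ (2 * Q)) (θ := 2) hD0 (Real.one_le_rpow one_le_two (by positivity)) one_lt_two
  refine ⟨min 1 (ε * c ^ Q), by positivity, fun x r hr hrd => ?_⟩
  obtain ⟨w, w', hw, hw', hdisj, hle⟩ := hballs x r hr hrd
  -- Only the case `μ (ball x r) ≤ r ^ Q` needs work; there this bound replaces the measure of the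
  -- averaging ball by `r ^ Q`.
  rcases le_total (ENNReal.ofReal (r ^ Q)) (μ (ball x r)) with hbig | hsmall
  · refine le_trans (ENNReal.ofReal_le_ofReal ?_) hbig
    exact mul_le_of_le_one_left (by positivity) (min_le_left _ _)
  set ρ := c * r with hρdef
  have hρ : 0 < ρ := by positivity
  have hmain : ENNReal.ofReal (ε * ρ ^ Q) ≤ μ (ball w ρ) := by
    refine key w ρ hρ fun j => ?_
    set R := nestedRadius ρ j with hRdef
    set R' := nestedRadius ρ (j + 1) with hRdef'
    have hR0 : 0 < R := nestedRadius_pos hρ j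
    have hR0' : 0 < R' := nestedRadius_pos hρ (j + 1)
    have hRρ : R ≤ ρ := nestedRadius_le hρ j
    have hR : R' < R := by
      have := nestedRadius_sub ρ j
      have h0 : 0 < ρ / (4 * 2 ^ j) := by positivity
      linarith
    have hdisjR : Disjoint (ball w R) (ball w' ρ) := hdisj.mono_left (ball_subset_ball hRρ)
    have hnc : ¬ ∃ k : ℝ, ∀ᵐ y ∂μ, bump w R' R y = k := by
      rintro ⟨k, hk⟩
      obtain ⟨y, hy, hyk⟩ := exists_mem_of_ae (hμ w R' hR0').1 hk
      obtain ⟨z, hz, hzk⟩ := exists_mem_of_ae (hμ w' ρ hρ).1 hk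
      rw [bump_eq_one hR hy] at hyk
      rw [bump_eq_zero hR (fun hz' => hdisjR.notMem_of_mem_left hz' hz)] at hzk
      exact one_ne_zero (hyk.trans hzk.symm)
    have hmem : MemHajlasz μ Q (bump w R' R) := memHajlasz_bump hμ w hR0 hR hQ
    set s := (hajlaszSeminorm μ Q (bump w R' R)).toReal with hs
    have hs0 : 0 < s := ENNReal.toReal_pos
      (fun h0 => hnc (exists_ae_eq_const_of_hajlaszSeminorm_eq_zero hQ h0)) hmem.2.ne
    set m := μ.real (ball w R) with hm
    set m' := μ.real (ball w R') with hm'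
    have hm0 : 0 < m := hμ.real_pos w hR0
    have hm0' : 0 < m' := hμ.real_pos w hR0'
    have hsm : s ≤ 4 * (2 ^ j / ρ) * m ^ (1 / Q) := by
      have := hajlaszSeminorm_bump_nestedRadius_le (μ := μ) w hρ hQ j
      rw [← hμ.ofReal_real w hR0, ENNReal.ofReal_rpow_of_pos hm0,
        ← ENNReal.ofReal_mul (by positivity)] at this
      exact ENNReal.toReal_le_of_le_ofReal (by positivity) this
    obtain ⟨-, hT⟩ := h x r hr hrd _ hmem hnc
    rw [setLAverage_eq, ENNReal.div_le_iff (hμ x r hr).1.ne' (hμ x r hr).2.ne] at hT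
    obtain ⟨S, hSm, hSB, hSμ, hSu⟩ : ∃ S, MeasurableSet S ∧ S ⊆ ball x r ∧
        μ (ball w R') ≤ μ S ∧
        ∀ y ∈ S, 1 / 2 ≤ |bump w R' R y - ⨍ y in ball x r, bump w R' R y ∂μ| := by
      rcases half_le_abs_bump_sub hR hdisjR (⨍ y in ball x r, bump w R' R y ∂μ) with hγ | hγ
      · exact ⟨_, measurableSet_ball, (ball_subset_ball (hR.le.trans hRρ)).trans hw, le_rfl, hγ⟩
      · exact ⟨_, measurableSet_ball, hw',
          (measure_mono (ball_subset_ball (hR.le.trans hRρ))).trans hle, hγ⟩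
    have h1 : Real.exp ((c₁ * (1 / 2 / s)) ^ ω) * m' ≤ c₂ * r ^ Q := by
      have : ENNReal.ofReal (Real.exp ((c₁ * (1 / 2 / s)) ^ ω)) * μ (ball w R') ≤
          ENNReal.ofReal c₂ * ENNReal.ofReal (r ^ Q) := by
        calc _ ≤ ENNReal.ofReal (Real.exp ((c₁ * (1 / 2 / s)) ^ ω)) * μ S := by gcongr
          _ = ∫⁻ _ in S, ENNReal.ofReal (Real.exp ((c₁ * (1 / 2 / s)) ^ ω)) ∂μ := by
            rw [setLIntegral_const]
          _ ≤ ∫⁻ y in S, ENNReal.ofReal (Real.exp ((c₁ *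
              (|bump w R' R y - ⨍ y in ball x r, bump w R' R y ∂μ| / s)) ^ ω)) ∂μ := by
            refine setLIntegral_mono' hSm fun y hy => ENNReal.ofReal_le_ofReal ?_
            have := hSu y hy
            gcongr
          _ ≤ _ := lintegral_mono_set hSB
          _ ≤ _ := hT
          _ ≤ _ := by gcongr
      rw [← hμ.ofReal_real w hR0', ← ENNReal.ofReal_mul (by positivity),
        ← ENNReal.ofReal_mul hc₂.le] at this
      exact (ENNReal.ofReal_le_ofReal_iff (by positivity)).1 this
    have h2 : (c₁ * (1 / 2 / s)) ^ (2 * Q) * m' ≤ a ^ a * (c₂ * r ^ Q) := by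
      have := rpow_le_mul_exp (z := (c₁ * (1 / 2 / s)) ^ ω) (by positivity) ha0
      rw [← Real.rpow_mul (by positivity), ha, mul_div_cancel₀ _ hω.ne', ← ha] at this
      calc _ ≤ a ^ a * Real.exp ((c₁ * (1 / 2 / s)) ^ ω) * m' := by gcongr
        _ = a ^ a * (Real.exp ((c₁ * (1 / 2 / s)) ^ ω) * m') := by ring
        _ ≤ _ := by gcongr
    have h3 : m' ≤ a ^ a * (c₂ * r ^ Q) * (8 / c₁ * (2 ^ j / ρ) * m ^ (1 / Q)) ^ (2 * Q) := by
      have e : c₁ * (1 / 2 / s) = (2 * s / c₁)⁻¹ := by field_simp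
      rw [e, Real.inv_rpow (by positivity), inv_mul_le_iff₀ (by positivity), mul_comm] at h2
      refine h2.trans ?_
      gcongr
      calc 2 * s / c₁ ≤ 2 * (4 * (2 ^ j / ρ) * m ^ (1 / Q)) / c₁ := by gcongr
        _ = _ := by ring
    rw [div_le_iff₀ (by positivity)]
    refine h3.trans (le_of_eq ?_)
    have e1 : ((2 : ℝ) ^ j) ^ (2 * Q) = (2 ^ (2 * Q)) ^ j := by
      rw [← Real.rpow_natCast_mul two_pos.le, mul_comm, Real.rpow_mul_natCast two_pos.le]
    have e2 : (m ^ (1 / Q)) ^ (2 * Q) = m ^ 2 := by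
      rw [← Real.rpow_mul hm0.le, ← Real.rpow_natCast]
      congr 1
      field_simp
      norm_num
    have e3 : ρ ^ (2 * Q) = ρ ^ Q * ρ ^ Q := by rw [two_mul, Real.rpow_add hρ]
    have e4 : ρ ^ Q = c ^ Q * r ^ Q := by rw [hρdef, Real.mul_rpow hc.le hr.le]
    rw [Real.mul_rpow (by positivity) (by positivity),
      Real.mul_rpow (by positivity) (by positivity), Real.div_rpow (by positivity) hρ.le, e1, e2,
      e3, Real.rpow_two, e4, hD]
    field_simp
  rw [hρdef, Real.mul_rpow hc.le hr.le, ← mul_assoc, ← hρdef] at hmain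
  refine le_trans (ENNReal.ofReal_le_ofReal ?_) (hmain.trans (measure_mono hw))
  gcongr
  exact min_le_right _ _

end Necessity

end HajlaszSobolev

theorem theorem1p4 {X : Type*} [MetricSpace X] [Nontrivial X] [MeasurableSpace X] [BorelSpace X]
    (μ : MeasureTheory.Measure X) (hμ : HajlaszSobolev.BallsPosFinite μ)
    (Q : ℝ) (hQ : 0 < Q)
    (hX : Bornology.IsBounded (Set.univ : Set X) ∨ HajlaszSobolev.QDoubling μ Q) :
    (HajlaszSobolev.LowerAhlforsRegular μ Q ↔ HajlaszSobolev.GlobalSobolev μ Q) ∧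
    (HajlaszSobolev.UniformlyPerfect X →
      List.TFAE [HajlaszSobolev.LowerAhlforsRegular μ Q,
        HajlaszSobolev.GlobalSobolev μ Q,
        HajlaszSobolev.GlobalSobolevPoincare μ Q,
        HajlaszSobolev.GlobalTrudinger μ Q,
        HajlaszSobolev.GlobalHolder μ Q]) := by
  have hab : HajlaszSobolev.LowerAhlforsRegular μ Q ↔ HajlaszSobolev.GlobalSobolev μ Q :=
    ⟨fun h => h.globalSobolev hQ hμ, fun h => h.lowerAhlforsRegular hμ⟩
  refine ⟨hab, fun hup => ?_⟩
  tfae_have 1 ↔ 2 := hab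
  tfae_have 1 → 3 := fun h => h.globalSobolevPoincare hQ hμ
  tfae_have 3 → 1 := fun h => h.lowerAhlforsRegular hμ hup
  tfae_have 1 → 4 := fun h => h.globalTrudinger hQ hμ
  tfae_have 4 → 1 := fun h => h.lowerAhlforsRegular hQ hμ hup
  tfae_have 1 → 5 := fun h => h.globalHolder hQ hμ
  tfae_have 5 → 1 := fun h => h.lowerAhlforsRegular hμ hup
  tfae_finish
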